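/- Let $N>0$ and $\ell>0$. The AdS-Taub-Nut metric is the Riemannian metric $$ds^2=\frac{dr^2}{A(r)}+4N^2A(r)\,\sigma_3^2+B(r)\,(\sigma_1^2+\sigma_2^2)\qquad\text{on } (N,\infty)\times SU(2),$$ where $\sigma_1,\sigma_2,\sigma_3$ are the left-invariant one-forms on $SU(2)$ with $d\sigma_1=-\sigma_2\wedge\sigma_3$ (and cyclic permutations), and $$A(r)=\frac{r^2+N^2-2mr+\ell^{-2}(r^4-6N^2r^2-3N^4)}{r^2-N^2},\qquad B(r)=r^2-N^2,\qquad m=\frac{N(\ell^2-4N^2)}{\ell^2}$$ (the nut is at $r_+=N$). Let $\widetilde\Delta_L h_{ab}=-\nabla^e\nabla_e h_{ab}-2R_{acbd}h^{cd}$, where the sign of the Riemann tensor is such that the unit sphere has $R_{abcd}=g_{ac}g_{bd}-g_{ad}g_{bc}$. A diagonal $SU(2)$-invariant perturbation (the diagonal $J=K=M=0$ sector) is a tensor $h=h_{00}\,dr^2+h_{11}\,\sigma_1^2+h_{22}\,\sigma_2^2+h_{33}\,\sigma_3^2$ on $r>N$ that is invariant under left translations of $SU(2)$ and whose components are $C^2$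 functions of $r$. Call $(f,g,r_*,V)$ *Schrödinger data* if $f,g:(N,\infty)\to(0,\infty)$ are smooth, $r_*:(N,\infty)\to(0,\infty)$ is a bijection with $dr=g\,dr_*$, and $V:(0,\infty)\to\mathbb R$ is smooth with $V(r_*(r))>0$ for all $r>N$. Then: 1. There are Schrödinger data $(f,g,r_*,V)$ such that for every diagonal $SU(2)$-invariant $h$, writing $h_{11}-h_{22}=f(r)\,\chi(r_*(r))$, $$(\widetilde\Delta_L h)_{11}-(\widetilde\Delta_L h)_{22}=f\,\Bigl(-\frac{d^2\chi}{dr_*^2}+V\chi\Bigr)\quad\text{for } r>N.$$ So the difference of the $11$ and $22$ components of $\widetilde\Delta_L h=\lambda h$ is the Schrödinger equation $-\chi''+V\chi=\lambda\chi$ on $0<r_*<\infty$ with a positive potential. 2. There are Schrödinger data $(f,g,r_*,V)$ such that for every transverse traceless diagonal $SU(2)$-invariant $h$, writing $h_{00}=f(r)\,\chi(r_*(r))$, $$(\widetilde\Delta_L h)_{00}=f\,\Bigl(-\frac{d^2\chi}{dr_*^2}+V\chi\Bigr)\quad\text{for } r>N.$$ So for transverse traceless $h$ the $00$ component of $\widetilde\Delta_L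 h=\lambda h$ decouples and is the Schrödinger equation $-\chi''+V\chi=\lambda\chi$ on $0<r_*<\infty$ with a positive potential. 3. There are no normalisable negative eigenmodes of $\widetilde\Delta_L$ in this sector: if $\lambda<0$ and $h$ is a transverse traceless diagonal $SU(2)$-invariant perturbation with $\widetilde\Delta_L h=\lambda h$ on $r>N$ and $\int h_{ab}h^{ab}\,dV<\infty$, then $h=0$. -/

import Mathlib

open Set MeasureTheory

open scoped ContDiff

namespace AdSTaubNUT

/-! ### The group `SU(2)` and its left-invariant vector fields -/

/-- The Lie group `SU(2)`. -/
abbrev SU2 : Type := Matrix.specialUnitaryGroup (Fin 2) ℂ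

instance : ContinuousInv SU2 where
  continuous_inv := by
    refine Continuous.subtype_mk ?_ _
    exact continuous_star.comp continuous_subtype_val

instance : IsTopologicalGroup SU2 where

instance : CompactSpace SU2 := by
  refine isCompact_iff_compactSpace.mp ?_
  have hK : IsCompact (Set.univ.pi (fun _ : Fin 2 => Set.univ.pi
      (fun _ : Fin 2 => Metric.closedBall (0 : ℂ) 1)) : Set (Matrix (Fin 2) (Fin 2) ℂ)) :=
    isCompact_univ_pi fun _ => isCompact_univ_pi fun _ => isCompact_closedBall _ _
  refine hK.of_isClosed_subset ?_ ?_
  · have h1 : IsClosed {A : Matrix (Fin 2) (Fin 2) ℂ | A * star A = 1} :=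
      isClosed_eq (continuous_id.mul continuous_star) continuous_const
    have h2 : IsClosed {A : Matrix (Fin 2) (Fin 2) ℂ | A.det = 1} :=
      isClosed_eq (Continuous.matrix_det continuous_id) continuous_const
    have h3 : {A : Matrix (Fin 2) (Fin 2) ℂ | A ∈ Matrix.specialUnitaryGroup (Fin 2) ℂ} =
        {A | A * star A = 1} ∩ {A | A.det = 1} := by
      ext A
      simp [Matrix.mem_specialUnitaryGroup_iff, Matrix.mem_unitaryGroup_iff]
    have h4 := h1.inter h2
    rw [← h3] at h4
    exact h4
  · intro A hA i _ j _
    rw [mem_closedBall_zero_iff]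
    exact entry_norm_bound_of_unitary (Matrix.mem_specialUnitaryGroup_iff.mp hA).1 i j

noncomputable instance : MeasurableSpace SU2 := borel SU2

instance : BorelSpace SU2 := ⟨rfl⟩

/-- The basis `τ_k = -(i/2) (k-th Pauli matrix)`, `k = 1, 2, 3`, of the Lie algebra `su(2)`. -/
noncomputable def tau : Fin 3 → Matrix (Fin 2) (Fin 2) ℂ
  | 0 => !![0, -(Complex.I / 2); -(Complex.I / 2), 0]
  | 1 => !![0, -(1 / 2); 1 / 2, 0]
  | 2 => !![-(Complex.I / 2), 0; 0, Complex.I / 2]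

/-- The Lie brackets `[τ_1, τ_2] = τ_3`, and cyclically. -/
theorem tau_bracket (k : Fin 3) :
    tau k * tau (k + 1) - tau (k + 1) * tau k = tau (k + 2) := by
  have hI : Complex.I * Complex.I = -1 := Complex.I_mul_I
  ext i j
  fin_cases k <;> fin_cases i <;> fin_cases j <;>
    simp [tau] <;> grind

theorem oneParam_mem (k : Fin 3) (t : ℝ) :
    (Real.cos (t / 2) : ℂ) • (1 : Matrix (Fin 2) (Fin 2) ℂ) + (2 * Real.sin (t / 2) : ℂ) • tau k ∈
      Matrix.specialUnitaryGroup (Fin 2) ℂ := by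
  have h : (Real.cos (t / 2) : ℂ) ^ 2 + (Real.sin (t / 2) : ℂ) ^ 2 = 1 := by
    exact_mod_cast Real.cos_sq_add_sin_sq (t / 2)
  have hI : Complex.I * Complex.I = -1 := Complex.I_mul_I
  generalize Real.cos (t / 2) = c at *
  generalize Real.sin (t / 2) = s at *
  rw [Matrix.mem_specialUnitaryGroup_iff, Matrix.mem_unitaryGroup_iff]
  constructor
  · ext i j
    fin_cases k <;> fin_cases i <;> fin_cases j <;>
      simp [tau, Matrix.mul_apply, Fin.sum_univ_two, Matrix.star_apply,
        Complex.conj_ofNat] <;> grind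
  · fin_cases k <;> simp [tau, Matrix.det_fin_two] <;> grind

/-- The one-parameter subgroup `exp (t τ_k) = cos (t/2) + 2 sin (t/2) τ_k` of `SU(2)`. -/
noncomputable def oneParam (k : Fin 3) (t : ℝ) : SU2 :=
  ⟨(Real.cos (t / 2) : ℂ) • (1 : Matrix (Fin 2) (Fin 2) ℂ) + (2 * Real.sin (t / 2) : ℂ) • tau k,
    oneParam_mem k t⟩

/-! ### Tensor calculus in the frame dual to `dr, σ₁, σ₂, σ₃`

A point is a pair `(r, q)` with `r` real and `q` in `SU(2)`. All tensor fields are given by their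
components in the global frame `e_0 = ∂_r`, `e_1, e_2, e_3`, where `e_k` is the left-invariant
vector field of `τ_k`. The dual coframe is `dr, σ₁, σ₂, σ₃` with `dσ₁ = - σ₂ ∧ σ₃` and cyclically. -/

/-- Scalar fields on `ℝ × SU(2)`. -/
abbrev Scalar : Type := ℝ × SU2 → ℝ

/-- Frame components of covariant tensor fields of rank 2. -/
abbrev Tensor2 : Type := Fin 4 → Fin 4 → Scalar

/-- Frame components of covariant tensor fields of rank 3. -/
abbrev Tensor3 : Type := Fin 4 → Fin 4 → Fin 4 → Scalar

/-- The derivative `e_a u` of a scalar field along the frame. -/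
noncomputable def frameDeriv (a : Fin 4) (u : Scalar) : Scalar := fun p =>
  Fin.cases (deriv (fun r => u (r, p.2)) p.1)
    (fun k => deriv (fun t => u (p.1, p.2 * oneParam k t)) 0) a

/-- The structure constants: `[e_a, e_b] = ∑ c, structConst a b c • e_c`. -/
def structConst : Fin 4 → Fin 4 → Fin 4 → ℝ
  | 1, 2, 3 => 1
  | 2, 3, 1 => 1
  | 3, 1, 2 => 1
  | 2, 1, 3 => -1
  | 3, 2, 1 => -1
  | 1, 3, 2 => -1
  | _, _, _ => 0

/-- The inverse metric `g^{ab}`. -/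
noncomputable def invMetric (g : Tensor2) (a b : Fin 4) : Scalar := fun p =>
  (Matrix.of fun i j => g i j p)⁻¹ a b

/-- `g (∇_{e_a} e_b, e_c)` for the Levi-Civita connection, by the Koszul formula. -/
noncomputable def koszul (g : Tensor2) (a b c : Fin 4) : Scalar := fun p =>
  (1 / 2) * (frameDeriv a (g b c) p + frameDeriv b (g a c) p - frameDeriv c (g a b) p
    + ∑ d, (structConst a b d * g d c p - structConst b c d * g d a p
      + structConst c a d * g d b p))

/-- The connection coefficients: `∇_{e_a} e_b = ∑ c, conn g a b c • e_c`. -/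
noncomputable def conn (g : Tensor2) (a b c : Fin 4) : Scalar := fun p =>
  ∑ d, invMetric g c d p * koszul g a b d p

/-- The components `∇_a T_{bc}`. -/
noncomputable def nabla2 (g : Tensor2) (T : Tensor2) : Tensor3 := fun a b c p =>
  frameDeriv a (T b c) p - ∑ d, (conn g a b d p * T d c p + conn g a c d p * T b d p)

/-- The components `∇_a T_{bcd}`. -/
noncomputable def nabla3 (g : Tensor2) (T : Tensor3) (a b c d : Fin 4) : Scalar := fun p =>
  frameDeriv a (T b c d) p - ∑ e, (conn g a b e p * T e c d p + conn g a c e p * T b e d p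
    + conn g a d e p * T b c e p)

/-- The curvature endomorphism: `R(e_a, e_b) e_c = ∑ d, curv g a b c d • e_d`, where
`R(X, Y) = ∇_X ∇_Y - ∇_Y ∇_X - ∇_{[X, Y]}`. -/
noncomputable def curv (g : Tensor2) (a b c d : Fin 4) : Scalar := fun p =>
  frameDeriv a (conn g b c d) p - frameDeriv b (conn g a c d) p
    + ∑ f, (conn g b c f p * conn g a f d p - conn g a c f p * conn g b f d p
      - structConst a b f * conn g f c d p)

/-- The Riemann tensor `R_{abcd} = g (R(e_a, e_b) e_d, e_c)`. With this sign the unit sphere has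
`R_{abcd} = g_{ac} g_{bd} - g_{ad} g_{bc}`, and the Ricci tensor is `R_{bd} = g^{ac} R_{abcd}`. -/
noncomputable def riemann (g : Tensor2) (a b c d : Fin 4) : Scalar := fun p =>
  ∑ f, g c f p * curv g a b d f p

/-- The trace `h^a_a`. -/
noncomputable def traceT (g h : Tensor2) : Scalar := fun p =>
  ∑ a, ∑ b, invMetric g a b p * h a b p

/-- The divergence `∇^a h_{ab}`. -/
noncomputable def divT (g h : Tensor2) (b : Fin 4) : Scalar := fun p =>
  ∑ a, ∑ c, invMetric g a c p * nabla2 g h a c b p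

/-- The pointwise square norm `h_{ab} h^{ab}`. -/
noncomputable def normSqT (g h : Tensor2) : Scalar := fun p =>
  ∑ a, ∑ b, ∑ c, ∑ d, invMetric g a c p * invMetric g b d p * h a b p * h c d p

/-- The modified Lichnerowicz operator
`(Δ̃_L h)_{ab} = - ∇^e ∇_e h_{ab} - 2 R_{acbd} h^{cd}`. -/
noncomputable def modLichnerowicz (g h : Tensor2) : Tensor2 := fun a b p =>
  - (∑ e, ∑ f, invMetric g e f p * nabla3 g (nabla2 g h) e f a b p)
    - 2 * ∑ c, ∑ d, riemann g a c b d p *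
        ∑ i, ∑ j, invMetric g c i p * invMetric g d j p * h i j p

/-! ### The AdS-Taub-NUT metrics -/

/-- `A(r) = (r² + N² - 2 m r + ℓ⁻² (r⁴ - 6 N² r² - 3 N⁴)) / (r² - N²)`. -/
noncomputable def coeffA (N ℓ m r : ℝ) : ℝ :=
  (r ^ 2 + N ^ 2 - 2 * m * r + (r ^ 4 - 6 * N ^ 2 * r ^ 2 - 3 * N ^ 4) / ℓ ^ 2) / (r ^ 2 - N ^ 2)

/-- `B(r) = r² - N²`. -/
def coeffB (N r : ℝ) : ℝ := r ^ 2 - N ^ 2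

/-- The metric `dr² / A + 4 N² A σ₃² + B (σ₁² + σ₂²)`. -/
noncomputable def taubNUT (N ℓ m : ℝ) : Tensor2 := fun a b p =>
  Matrix.diagonal ![1 / coeffA N ℓ m p.1, coeffB N p.1, coeffB N p.1,
    4 * N ^ 2 * coeffA N ℓ m p.1] a b

/-- The AdS-Taub-Nut metric, `m = N (ℓ² - 4 N²) / ℓ²`, whose nut is at `r = N`. -/
noncomputable def nutMetric (N ℓ : ℝ) : Tensor2 := taubNUT N ℓ (N * (ℓ ^ 2 - 4 * N ^ 2) / ℓ ^ 2)

/-! ### Perturbations on `r > r₀` -/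

/-- `h` is a `C²` symmetric tensor field on `r > r₀`, diagonal with respect to
`dr, σ₁, σ₂, σ₃` and invariant under left translations by `SU(2)`. -/
structure IsDiagonalInvariant (r₀ : ℝ) (h : Tensor2) : Prop where
  contDiff : ∀ a b q, ContDiffOn ℝ 2 (fun r => h a b (r, q)) (Ioi r₀)
  diagonal : ∀ a b, a ≠ b → ∀ r, r₀ < r → ∀ q, h a b (r, q) = 0
  invariant : ∀ a b, ∀ r, r₀ < r → ∀ u q : SU2, h a b (r, u * q) = h a b (r, q)

/-- `h` is transverse and traceless on `r > r₀`. -/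
structure IsTT (g : Tensor2) (r₀ : ℝ) (h : Tensor2) : Prop where
  traceless : ∀ r, r₀ < r → ∀ q, traceT g h (r, q) = 0
  transverse : ∀ b, ∀ r, r₀ < r → ∀ q, divT g h b (r, q) = 0

/-- `∫ h_{ab} h^{ab} dV < ∞` over `r > r₀`. Here `σ₁ ∧ σ₂ ∧ σ₃` is a constant multiple of the Haar
measure, and the constant plays no role for finiteness. -/
def IsNormalisable (g : Tensor2) (r₀ : ℝ) (h : Tensor2) : Prop :=
  IntegrableOn
    (fun p : ℝ × SU2 => normSqT g h p * Real.sqrt |(Matrix.of fun i j => g i j p).det|)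
    (Ioi r₀ ×ˢ univ) ((volume : Measure ℝ).prod Measure.haar)

/-- `(Δ̃_L h)_{ab} = lam h_{ab}` on `r > r₀`. -/
def IsEigenmode (g : Tensor2) (r₀ : ℝ) (lam : ℝ) (h : Tensor2) : Prop :=
  ∀ a b, ∀ r, r₀ < r → ∀ q, modLichnerowicz g h a b (r, q) = lam * h a b (r, q)

/-! ### Schrödinger form -/

/-- The operator `χ ↦ - χ'' + V χ`. -/
noncomputable def schrodingerOp (V χ : ℝ → ℝ) (x : ℝ) : ℝ := - deriv (deriv χ) x + V x * χ x

/-- Data for the substitution `Y = f χ`, `dr = gg dr_*` on `r > r₀`, where `r_* = rstar r` runs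
over `(0, ∞)`, together with a smooth potential `V(r_*)` that is positive for `r > r₀`. -/
structure IsSchrodingerData (r₀ : ℝ) (f gg rstar V : ℝ → ℝ) : Prop where
  f_smooth : ContDiffOn ℝ ∞ f (Ioi r₀)
  f_pos : ∀ r, r₀ < r → 0 < f r
  gg_smooth : ContDiffOn ℝ ∞ gg (Ioi r₀)
  gg_pos : ∀ r, r₀ < r → 0 < gg r
  rstar_deriv : ∀ r, r₀ < r → HasDerivAt rstar (1 / gg r) r
  rstar_bijOn : BijOn rstar (Ioi r₀) (Ioi 0)
  V_smooth : ContDiffOn ℝ ∞ V (Ioi 0)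
  V_pos : ∀ r, r₀ < r → 0 < V (rstar r)

/-- The quantity `LY`, which for an eigenmode with eigenvalue `lam` equals `lam Y`, is given on
`r > r₀` by the Schrödinger operator: if `Y = f χ(r_*)` then `LY = f (- χ'' + V χ)(r_*)`. Hence
`LY = lam Y` for `r > r₀` if and only if `- χ'' + V χ = lam χ` for `r_* > 0`. -/
def HasSchrodingerForm (r₀ : ℝ) (f rstar V : ℝ → ℝ) (Y LY : Scalar) : Prop :=
  ∀ χ : ℝ → ℝ, ContDiffOn ℝ 2 χ (Ioi 0) →
    (∀ r, r₀ < r → ∀ q, Y (r, q) = f r * χ (rstar r)) →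
    ∀ r, r₀ < r → ∀ q, LY (r, q) = f r * schrodingerOp V χ (rstar r)

end AdSTaubNUT

/-! Left invariance and diagonality make every tensor in sight a function of `r` alone, so the
modified Lichnerowicz operator becomes a system of ordinary differential expressions in the mixed
components `y_a = h^a_a`. Write `b = B'/(2B)`, `c = A'/(2A)`, `L = ℓ⁻²` and `E = 1 + L (r - N)(r +
3N)`, so that `A = (r - N) E / (r + N)`.

The difference `y_1 - y_2` decouples for any `A` and `B`, because all other components enter the
`11` and `22` equations identically (`lichMixed_one_sub_two`). The `00` equation contains `y_1 +
y_2` and `y_3`. The trace condition removes `y_1 + y_2`, and transversality becomes `y_0' + (3b + c)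
y_0 + (b - c) y_3 = 0`. Since `b - c = (1 - 4N²L) / (E (r + N))` has an explicit logarithmic
derivative, the coefficient of `y_3` left in the `00` equation is a multiple of `b - c`. Hence `y_3`
is eliminated without division, even when `ℓ = 2N` (`modLichnerowicz_zero`).

With `r_*` the proper distance from the nut and a weight that kills the first order term, both
equations take Schrödinger form with explicit positive potentials (`potDiff_pos`, `potRadial_pos`).

For `λ < 0` the profile satisfies `χ'' = U χ` with `U ≥ 0`, so `χ χ'` is nondecreasing. If it is
positive somewhere, `χ²` and `χ'²` stay bounded below further out, against normalisability; so `χ χ'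
≤ 0` everywhere. Then, unless `χ = 0`, the bound `U ≥ 6/x²` near the nut forces growth at least like
`x⁻²`, against square integrability of `x χ` (`eq_zero_of_decaying`). For `y_0` the weight is too
weak at infinity to control `χ`; the norm of `y_3`, which controls `y_0' + (3b + c) y_0`, is used
there instead (`eq_zero_of_radial`).

Thus `y_0 = 0` and `y_1 = y_2`. If `ℓ ≠ 2N`, transversality gives `y_3 = 0` and the trace finishes.
If `ℓ = 2N`, then `B = 4N²A`, the three directions of `SU(2)` are equivalent, and the argument for
`y_1 - y_2` also gives `y_1 = y_3`. -/

namespace AdSTaubNUT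

/-! ### Levi-Civita calculus of diagonal tensors depending only on `r`. -/

/-- The covariant 2-tensor with diagonal frame components `G a (r)`. -/
def radialDiag (G : Fin 4 → ℝ → ℝ) : Tensor2 := fun a b p => if a = b then G a p.1 else 0

/-- Koszul formula for a radial diagonal metric with values `g` and derivatives `g'`. -/
noncomputable def koszulDiag (g g' : Fin 4 → ℝ) (a b c : Fin 4) : ℝ :=
  (1 / 2) * ((if a = 0 then (if b = c then g' b else 0) else 0)
    + (if b = 0 then (if a = c then g' a else 0) else 0)
    - (if c = 0 then (if a = b then g' a else 0) else 0)
    + (structConst a b c * g c - structConst b c a * g a + structConst c a b * g b))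

/-- Connection coefficients of a radial diagonal metric. -/
noncomputable def connDiag (g g' : Fin 4 → ℝ) (a b c : Fin 4) : ℝ :=
  koszulDiag g g' a b c / g c

/-- Radial derivative of `connDiag`. -/
noncomputable def connDiagDeriv (g g' g'' : Fin 4 → ℝ) (a b c : Fin 4) : ℝ :=
  (koszulDiag g' g'' a b c * g c - koszulDiag g g' a b c * g' c) / g c ^ 2

/-- Covariant derivative of a radial diagonal 2-tensor. -/
noncomputable def nablaDiag (g g' H H' : Fin 4 → ℝ) (a b c : Fin 4) : ℝ :=
  (if a = 0 then (if b = c then H' b else 0) else 0)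
    - (connDiag g g' a b c * H c + connDiag g g' a c b * H b)

/-- Radial derivative of `nablaDiag`. -/
noncomputable def nablaDiagDeriv (g g' g'' H H' H'' : Fin 4 → ℝ) (a b c : Fin 4) : ℝ :=
  (if a = 0 then (if b = c then H'' b else 0) else 0)
    - ((connDiagDeriv g g' g'' a b c * H c + connDiag g g' a b c * H' c)
      + (connDiagDeriv g g' g'' a c b * H b + connDiag g g' a c b * H' b))

/-- Curvature `R(e_a, e_b) e_c` of a radial diagonal metric. -/
noncomputable def curvDiag (g g' g'' : Fin 4 → ℝ) (a b c d : Fin 4) : ℝ :=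
  (if a = 0 then connDiagDeriv g g' g'' b c d else 0)
    - (if b = 0 then connDiagDeriv g g' g'' a c d else 0)
    + ∑ f, (connDiag g g' b c f * connDiag g g' a f d - connDiag g g' a c f * connDiag g g' b f d
      - structConst a b f * connDiag g g' f c d)

/-- The modified Lichnerowicz operator on a radial diagonal 2-tensor. -/
noncomputable def lichDiag (g g' g'' H H' H'' : Fin 4 → ℝ) (a b : Fin 4) : ℝ :=
  - (∑ e, 1 / g e * ((if e = 0 then nablaDiagDeriv g g' g'' H H' H'' e a b else 0)
      - ∑ d, (connDiag g g' e e d * nablaDiag g g' H H' d a b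
        + connDiag g g' e a d * nablaDiag g g' H H' e d b
        + connDiag g g' e b d * nablaDiag g g' H H' e a d)))
    - 2 * ∑ c, g b * curvDiag g g' g'' a c c b * (H c / g c ^ 2)

/-- Left-invariant fields annihilate functions of `r`, and `∂_r` is local, so agreement with `v` on
the open half-line is enough. -/
theorem frameDeriv_of_radial {r₀ : ℝ} {u : Scalar} {v : ℝ → ℝ}
    (h : ∀ r, r₀ < r → ∀ q, u (r, q) = v r) (a : Fin 4) {r v' : ℝ} (hr : r₀ < r)
    (hv : HasDerivAt v v' r) (q : SU2) :
    frameDeriv a u (r, q) = if a = 0 then v' else 0 := by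
  refine Fin.cases ?_ (fun k => ?_) a
  · have : (fun s => u (s, q)) =ᶠ[nhds r] v := by
      filter_upwards [Ioi_mem_nhds hr] with s hs using h s hs q
    simp only [frameDeriv, Fin.cases_zero, if_true]
    rw [this.deriv_eq, hv.deriv]
  · simp [frameDeriv, Fin.succ_ne_zero, h r hr]

section

variable {r₀ : ℝ} {G G' G'' H H' H'' : Fin 4 → ℝ → ℝ}

theorem invMetric_radialDiag {r : ℝ} (hG : ∀ a, G a r ≠ 0) (a b : Fin 4) (q : SU2) :
    invMetric (radialDiag G) a b (r, q) = if a = b then 1 / G a r else 0 := by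
  have : (Matrix.of fun i j => radialDiag G i j (r, q)) = Matrix.diagonal (fun i => G i r) := by
    ext i j; simp [radialDiag, Matrix.diagonal_apply]
  rw [invMetric, this]
  have h2 : (Matrix.diagonal (fun i => G i r))⁻¹ = Matrix.diagonal (fun i => 1 / G i r) := by
    apply Matrix.inv_eq_right_inv
    rw [Matrix.diagonal_mul_diagonal, ← Matrix.diagonal_one]
    congr 1; ext i; simp [hG i]
  rw [h2, Matrix.diagonal_apply]

theorem frameDeriv_radialDiag (hG' : ∀ a r, r₀ < r → HasDerivAt (G a) (G' a r) r)
    (a b c : Fin 4) {r : ℝ} (hr : r₀ < r) (q : SU2) :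
    frameDeriv a (radialDiag G b c) (r, q) =
      if a = 0 then (if b = c then G' b r else 0) else 0 := by
  refine frameDeriv_of_radial (r₀ := r₀) (v := fun s => if b = c then G b s else 0)
    (fun _ _ _ => rfl) a hr ?_ q
  split_ifs
  · exact hG' b r hr
  · exact hasDerivAt_const _ _

theorem koszul_radialDiag (hG' : ∀ a r, r₀ < r → HasDerivAt (G a) (G' a r) r)
    (a b c : Fin 4) {r : ℝ} (hr : r₀ < r) (q : SU2) :
    koszul (radialDiag G) a b c (r, q) = koszulDiag (G · r) (G' · r) a b c := by
  simp only [koszul, koszulDiag, frameDeriv_radialDiag hG' _ _ _ hr]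
  simp [radialDiag, Finset.sum_add_distrib, Finset.sum_sub_distrib]

theorem conn_radialDiag (hG' : ∀ a r, r₀ < r → HasDerivAt (G a) (G' a r) r)
    (hG : ∀ a r, r₀ < r → G a r ≠ 0)
    (a b c : Fin 4) {r : ℝ} (hr : r₀ < r) (q : SU2) :
    conn (radialDiag G) a b c (r, q) = connDiag (G · r) (G' · r) a b c := by
  simp only [conn, koszul_radialDiag hG' _ _ _ hr, invMetric_radialDiag (fun a => hG a r hr)]
  simp [connDiag]; ring

/-- `koszulDiag` is linear in the pair `(g, g')`, so its derivative is the same expression evaluated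
at `(g', g'')`. -/
theorem hasDerivAt_koszulDiag (hG' : ∀ a r, r₀ < r → HasDerivAt (G a) (G' a r) r)
    (hG'' : ∀ a r, r₀ < r → HasDerivAt (G' a) (G'' a r) r)
    (a b c : Fin 4) {r : ℝ} (hr : r₀ < r) :
    HasDerivAt (fun s => koszulDiag (G · s) (G' · s) a b c)
      (koszulDiag (G' · r) (G'' · r) a b c) r := by
  have key : ∀ (P Q : Prop) [Decidable P] [Decidable Q] (i : Fin 4),
      HasDerivAt (fun s => if P then (if Q then G' i s else 0) else 0)
        (if P then (if Q then G'' i r else 0) else 0) r := by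
    intro P Q _ _ i
    split_ifs
    · exact hG'' i r hr
    · exact hasDerivAt_const _ _
    · exact hasDerivAt_const _ _
  exact ((((key _ _ _).add (key _ _ _)).sub (key _ _ _)).add
    ((((hG' c r hr).const_mul _).sub ((hG' a r hr).const_mul _)).add
      ((hG' b r hr).const_mul _))).const_mul _

theorem hasDerivAt_connDiag (hG' : ∀ a r, r₀ < r → HasDerivAt (G a) (G' a r) r)
    (hG'' : ∀ a r, r₀ < r → HasDerivAt (G' a) (G'' a r) r)
    (hG : ∀ a r, r₀ < r → G a r ≠ 0)
    (a b c : Fin 4) {r : ℝ} (hr : r₀ < r) :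
    HasDerivAt (fun s => connDiag (G · s) (G' · s) a b c)
      (connDiagDeriv (G · r) (G' · r) (G'' · r) a b c) r :=
  (hasDerivAt_koszulDiag hG' hG'' a b c hr).div (hG' c r hr) (hG c r hr)

theorem nabla2_radialDiag {h : Tensor2}
    (hh : ∀ a b r, r₀ < r → ∀ q, h a b (r, q) = radialDiag H a b (r, q))
    (hG' : ∀ a r, r₀ < r → HasDerivAt (G a) (G' a r) r)
    (hG : ∀ a r, r₀ < r → G a r ≠ 0)
    (hH' : ∀ a r, r₀ < r → HasDerivAt (H a) (H' a r) r)
    (a b c : Fin 4) {r : ℝ} (hr : r₀ < r) (q : SU2) :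
    nabla2 (radialDiag G) h a b c (r, q) = nablaDiag (G · r) (G' · r) (H · r) (H' · r) a b c := by
  have h1 : frameDeriv a (h b c) (r, q) = if a = 0 then (if b = c then H' b r else 0) else 0 := by
    refine frameDeriv_of_radial (r₀ := r₀) (v := fun s => if b = c then H b s else 0)
      (fun s hs q => hh b c s hs q) a hr ?_ q
    split_ifs
    · exact hH' b r hr
    · exact hasDerivAt_const _ _
  simp only [nabla2, h1, conn_radialDiag hG' hG _ _ _ hr, hh _ _ r hr]
  simp [nablaDiag, radialDiag, Finset.sum_add_distrib]

theorem hasDerivAt_nablaDiag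
    (hG' : ∀ a r, r₀ < r → HasDerivAt (G a) (G' a r) r)
    (hG'' : ∀ a r, r₀ < r → HasDerivAt (G' a) (G'' a r) r)
    (hG : ∀ a r, r₀ < r → G a r ≠ 0)
    (hH' : ∀ a r, r₀ < r → HasDerivAt (H a) (H' a r) r)
    (hH'' : ∀ a r, r₀ < r → HasDerivAt (H' a) (H'' a r) r)
    (a b c : Fin 4) {r : ℝ} (hr : r₀ < r) :
    HasDerivAt (fun s => nablaDiag (G · s) (G' · s) (H · s) (H' · s) a b c)
      (nablaDiagDeriv (G · r) (G' · r) (G'' · r) (H · r) (H' · r) (H'' · r) a b c) r := by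
  have key : HasDerivAt (fun s => if a = 0 then (if b = c then H' b s else 0) else 0)
        (if a = 0 then (if b = c then H'' b r else 0) else 0) r := by
    split_ifs
    · exact hH'' b r hr
    · exact hasDerivAt_const _ _
    · exact hasDerivAt_const _ _
  exact key.sub (((hasDerivAt_connDiag hG' hG'' hG a b c hr).mul (hH' c r hr)).add
    ((hasDerivAt_connDiag hG' hG'' hG a c b hr).mul (hH' b r hr)))

theorem curv_radialDiag (hG' : ∀ a r, r₀ < r → HasDerivAt (G a) (G' a r) r)
    (hG'' : ∀ a r, r₀ < r → HasDerivAt (G' a) (G'' a r) r)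
    (hG : ∀ a r, r₀ < r → G a r ≠ 0)
    (a b c d : Fin 4) {r : ℝ} (hr : r₀ < r) (q : SU2) :
    curv (radialDiag G) a b c d (r, q) = curvDiag (G · r) (G' · r) (G'' · r) a b c d := by
  have h1 : ∀ a b c d : Fin 4, frameDeriv a (conn (radialDiag G) b c d) (r, q) =
      if a = 0 then connDiagDeriv (G · r) (G' · r) (G'' · r) b c d else 0 := fun a b c d =>
    frameDeriv_of_radial (r₀ := r₀) (fun s hs q => conn_radialDiag hG' hG b c d hs q) a hr
      (hasDerivAt_connDiag hG' hG'' hG b c d hr) q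
  simp only [curv, curvDiag, h1, conn_radialDiag hG' hG _ _ _ hr]

/-- The modified Lichnerowicz operator reduces to an ordinary differential expression on radial
diagonal tensors. -/
theorem modLichnerowicz_radialDiag {h : Tensor2}
    (hh : ∀ a b r, r₀ < r → ∀ q, h a b (r, q) = radialDiag H a b (r, q))
    (hG' : ∀ a r, r₀ < r → HasDerivAt (G a) (G' a r) r)
    (hG'' : ∀ a r, r₀ < r → HasDerivAt (G' a) (G'' a r) r)
    (hG : ∀ a r, r₀ < r → G a r ≠ 0)
    (hH' : ∀ a r, r₀ < r → HasDerivAt (H a) (H' a r) r)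
    (hH'' : ∀ a r, r₀ < r → HasDerivAt (H' a) (H'' a r) r)
    (a b : Fin 4) {r : ℝ} (hr : r₀ < r) (q : SU2) :
    modLichnerowicz (radialDiag G) h a b (r, q) =
      lichDiag (G · r) (G' · r) (G'' · r) (H · r) (H' · r) (H'' · r) a b := by
  have h1 : ∀ e a b c : Fin 4, frameDeriv e (nabla2 (radialDiag G) h a b c) (r, q) =
      if e = 0 then nablaDiagDeriv (G · r) (G' · r) (G'' · r) (H · r) (H' · r) (H'' · r) a b c
      else 0 := fun e a b c =>
    frameDeriv_of_radial (r₀ := r₀) (fun s hs q => nabla2_radialDiag hh hG' hG hH' a b c hs q)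
      e hr (hasDerivAt_nablaDiag hG' hG'' hG hH' hH'' a b c hr) q
  -- Raising the indices of a diagonal `h` keeps only `c = d`, so only the curvature components
  -- `R_{acbc}` survive.
  have h2 : ∀ c d : Fin 4, (∑ i, ∑ j, invMetric (radialDiag G) c i (r, q)
      * invMetric (radialDiag G) d j (r, q) * h i j (r, q)) =
      if c = d then H c r / G c r ^ 2 else 0 := by
    intro c d
    simp only [hh _ _ r hr, invMetric_radialDiag (fun a => hG a r hr)]
    simp only [radialDiag, ite_mul, mul_ite, zero_mul, mul_zero, Finset.sum_ite_eq,
      Finset.mem_univ, if_true]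
    split_ifs with hcd
    · subst hcd; simp; field_simp
    · rfl
  have h3 : ∀ c, riemann (radialDiag G) a c b c (r, q) =
      G b r * curvDiag (G · r) (G' · r) (G'' · r) a c c b := by
    intro c
    simp only [riemann, curv_radialDiag hG' hG'' hG _ _ _ _ hr]
    simp [radialDiag]
  simp only [modLichnerowicz, h2]
  simp only [lichDiag, nabla3, h1, invMetric_radialDiag (fun a => hG a r hr),
    conn_radialDiag hG' hG _ _ _ hr, nabla2_radialDiag hh hG' hG hH' _ _ _ hr]
  simp only [ite_mul, mul_ite, zero_mul, mul_zero, Finset.sum_ite_eq, Finset.mem_univ, if_true, h3]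

theorem traceT_radialDiag {h : Tensor2} {r : ℝ}
    (q : SU2) (hh : ∀ a b, h a b (r, q) = radialDiag H a b (r, q)) (hG : ∀ a, G a r ≠ 0) :
    traceT (radialDiag G) h (r, q) = ∑ a, H a r / G a r := by
  simp only [traceT, hh, invMetric_radialDiag hG]
  simp [radialDiag]
  exact Finset.sum_congr rfl fun a _ => by ring

theorem divT_radialDiag {h : Tensor2}
    (hh : ∀ a b r, r₀ < r → ∀ q, h a b (r, q) = radialDiag H a b (r, q))
    (hG' : ∀ a r, r₀ < r → HasDerivAt (G a) (G' a r) r)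
    (hG : ∀ a r, r₀ < r → G a r ≠ 0)
    (hH' : ∀ a r, r₀ < r → HasDerivAt (H a) (H' a r) r)
    (b : Fin 4) {r : ℝ} (hr : r₀ < r) (q : SU2) :
    divT (radialDiag G) h b (r, q) =
      ∑ a, 1 / G a r * nablaDiag (G · r) (G' · r) (H · r) (H' · r) a a b := by
  simp only [divT, invMetric_radialDiag (fun a => hG a r hr),
    nabla2_radialDiag hh hG' hG hH' _ _ _ hr]
  simp

theorem normSqT_radialDiag {h : Tensor2} {r : ℝ}
    (q : SU2) (hh : ∀ a b, h a b (r, q) = radialDiag H a b (r, q)) (hG : ∀ a, G a r ≠ 0) :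
    normSqT (radialDiag G) h (r, q) = ∑ a, (H a r / G a r) ^ 2 := by
  simp only [normSqT, hh, invMetric_radialDiag hG]
  simp [radialDiag]
  exact Finset.sum_congr rfl fun a _ => by ring

theorem det_radialDiag (r : ℝ) (q : SU2) :
    (Matrix.of fun i j => radialDiag G i j (r, q)).det = ∏ a, G a r := by
  have : (Matrix.of fun i j => radialDiag G i j (r, q)) = Matrix.diagonal (fun i => G i r) := by
    ext i j; simp [radialDiag, Matrix.diagonal_apply]
  rw [this, Matrix.det_diagonal]

end

/-! ### Closed forms of the operator and the divergence on mixed components. -/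

/-- Replaces the case distinctions in `connDiag` by a lookup with explicit zeros, so that the index
sums in `lichDiag` collapse under `simp`. -/
theorem connDiag_table (g g' : Fin 4 → ℝ) (hg : ∀ a, g a ≠ 0) : connDiag g g' =
    ![![![g' 0 / (2 * g 0), 0, 0, 0], ![0, g' 1 / (2 * g 1), 0, 0], ![0, 0, g' 2 / (2 * g 2), 0],
        ![0, 0, 0, g' 3 / (2 * g 3)]],
      ![![0, g' 1 / (2 * g 1), 0, 0], ![-(g' 1) / (2 * g 0), 0, 0, 0],
        ![0, 0, 0, (g 3 + g 2 - g 1) / (2 * g 3)], ![0, 0, -(g 3 + g 2 - g 1) / (2 * g 2), 0]],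
      ![![0, 0, g' 2 / (2 * g 2), 0], ![0, 0, 0, -(g 1 + g 3 - g 2) / (2 * g 3)],
        ![-(g' 2) / (2 * g 0), 0, 0, 0], ![0, (g 1 + g 3 - g 2) / (2 * g 1), 0, 0]],
      ![![0, 0, 0, g' 3 / (2 * g 3)], ![0, 0, (g 1 + g 2 - g 3) / (2 * g 2), 0],
        ![0, -(g 1 + g 2 - g 3) / (2 * g 1), 0, 0], ![-(g' 3) / (2 * g 0), 0, 0, 0]]] := by
  have h0 := hg 0
  have h1 := hg 1
  have h2 := hg 2
  have h3 := hg 3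
  funext a b c
  fin_cases a <;> fin_cases b <;> fin_cases c <;>
    simp [connDiag, koszulDiag, structConst] <;> (try field_simp) <;> (try ring)

theorem connDiagDeriv_table (g g' g'' : Fin 4 → ℝ) (hg : ∀ a, g a ≠ 0) :
    connDiagDeriv g g' g'' =
    ![![![(g'' 0 * g 0 - g' 0 ^ 2) / (2 * g 0 ^ 2), 0, 0, 0],
        ![0, (g'' 1 * g 1 - g' 1 ^ 2) / (2 * g 1 ^ 2), 0, 0],
        ![0, 0, (g'' 2 * g 2 - g' 2 ^ 2) / (2 * g 2 ^ 2), 0],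
        ![0, 0, 0, (g'' 3 * g 3 - g' 3 ^ 2) / (2 * g 3 ^ 2)]],
      ![![0, (g'' 1 * g 1 - g' 1 ^ 2) / (2 * g 1 ^ 2), 0, 0],
        ![-(g'' 1 * g 0 - g' 1 * g' 0) / (2 * g 0 ^ 2), 0, 0, 0],
        ![0, 0, 0, ((g' 3 + g' 2 - g' 1) * g 3 - (g 3 + g 2 - g 1) * g' 3) / (2 * g 3 ^ 2)],
        ![0, 0, -((g' 3 + g' 2 - g' 1) * g 2 - (g 3 + g 2 - g 1) * g' 2) / (2 * g 2 ^ 2), 0]],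
      ![![0, 0, (g'' 2 * g 2 - g' 2 ^ 2) / (2 * g 2 ^ 2), 0],
        ![0, 0, 0, -((g' 1 + g' 3 - g' 2) * g 3 - (g 1 + g 3 - g 2) * g' 3) / (2 * g 3 ^ 2)],
        ![-(g'' 2 * g 0 - g' 2 * g' 0) / (2 * g 0 ^ 2), 0, 0, 0],
        ![0, ((g' 1 + g' 3 - g' 2) * g 1 - (g 1 + g 3 - g 2) * g' 1) / (2 * g 1 ^ 2), 0, 0]],
      ![![0, 0, 0, (g'' 3 * g 3 - g' 3 ^ 2) / (2 * g 3 ^ 2)],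
        ![0, 0, ((g' 1 + g' 2 - g' 3) * g 2 - (g 1 + g 2 - g 3) * g' 2) / (2 * g 2 ^ 2), 0],
        ![0, -((g' 1 + g' 2 - g' 3) * g 1 - (g 1 + g 2 - g 3) * g' 1) / (2 * g 1 ^ 2), 0, 0],
        ![-(g'' 3 * g 0 - g' 3 * g' 0) / (2 * g 0 ^ 2), 0, 0, 0]]] := by
  have h0 := hg 0
  have h1 := hg 1
  have h2 := hg 2
  have h3 := hg 3
  funext a b c
  fin_cases a <;> fin_cases b <;> fin_cases c <;>
    simp [connDiagDeriv, koszulDiag, structConst] <;> (try field_simp) <;> (try ring)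

/-- Values of the metric `dr²/A + B (σ₁² + σ₂²) + 4N²A σ₃²` on the frame. -/
noncomputable def metricVal (N A B : ℝ) : Fin 4 → ℝ := ![1 / A, B, B, 4 * N ^ 2 * A]

/-- First radial derivative of `metricVal`. -/
noncomputable def metricVal' (N A A₁ B₁ : ℝ) : Fin 4 → ℝ :=
  ![-A₁ / A ^ 2, B₁, B₁, 4 * N ^ 2 * A₁]

/-- Second radial derivative of `metricVal`. -/
noncomputable def metricVal'' (N A A₁ A₂ B₂ : ℝ) : Fin 4 → ℝ :=
  ![(2 * A₁ ^ 2 - A * A₂) / A ^ 3, B₂, B₂, 4 * N ^ 2 * A₂]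

section

variable {N A A₁ A₂ B B₁ B₂ : ℝ} {y y' y'' : Fin 4 → ℝ}

theorem metricVal_ne_zero (hN : N ≠ 0) (hA : A ≠ 0) (hB : B ≠ 0) (a : Fin 4) :
    metricVal N A B a ≠ 0 := by
  fin_cases a <;> simp [metricVal, hN, hA, hB]

/-- `lichDiag` of the metric `metricVal`, on `h` with mixed components `y`. -/
noncomputable def lichMixed (N A A₁ A₂ B B₁ B₂ : ℝ) (y y' y'' : Fin 4 → ℝ) (a : Fin 4) : ℝ :=
  let g := metricVal N A B
  let g' := metricVal' N A A₁ B₁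
  let g'' := metricVal'' N A A₁ A₂ B₂
  lichDiag g g' g'' (fun a => g a * y a) (fun a => g' a * y a + g a * y' a)
    (fun a => g'' a * y a + 2 * (g' a * y' a) + g a * y'' a) a a

/-- The radial values are free numbers here, and no field equation is used. The coefficients are
left in terms of `B'/(2B)`, `A'/(2A)` and their derivatives, the shape in which the trace and
divergence conditions are later substituted. -/
theorem lichMixed_zero (hN : N ≠ 0) (hA : A ≠ 0) (hB : B ≠ 0) :
    lichMixed N A A₁ A₂ B B₁ B₂ y y' y'' 0 = (1 / A) *
      (-A * y'' 0 - (A₁ + A * B₁ / B) * y' 0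
        + 2 * A * (2 * (B₁ / (2 * B)) ^ 2 + (A₁ / (2 * A)) ^ 2) * y 0
        + 2 * (A * ((B₂ * B - B₁ ^ 2) / (2 * B ^ 2)) + A₁ / 2 * (B₁ / (2 * B))) * (y 1 + y 2)
        + 2 * (A * ((A₂ * A - A₁ ^ 2) / (2 * A ^ 2)) + A₁ / 2 * (A₁ / (2 * A))) * y 3) := by
  have hg := metricVal_ne_zero hN hA hB
  simp only [lichMixed, lichDiag, curvDiag, Fin.sum_univ_four, nablaDiag, nablaDiagDeriv]
  simp only [connDiag_table _ _ hg, connDiagDeriv_table _ _ _ hg]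
  simp [structConst, metricVal, metricVal', metricVal'']
  field_simp
  ring

/-- The metric is symmetric under exchange of `σ₁` and `σ₂`, so `y 0` and `y 3` contribute equally
to both components and cancel. What remains is minus the radial scalar Laplacian, `-(A B u')' / B`
with `u = y 1 - y 2`, plus a zeroth order term. -/
theorem lichMixed_one_sub_two (hN : N ≠ 0) (hA : A ≠ 0) (hB : B ≠ 0) :
    lichMixed N A A₁ A₂ B B₁ B₂ y y' y'' 1 - lichMixed N A A₁ A₂ B B₁ B₂ y y' y'' 2 = B *
      (-A * (y'' 1 - y'' 2) - (A₁ + A * B₁ / B) * (y' 1 - y' 2)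
        + (1 / (N ^ 2 * A) - 2 / B) * (y 1 - y 2)) := by
  have hg := metricVal_ne_zero hN hA hB
  simp only [lichMixed, lichDiag, curvDiag, Fin.sum_univ_four, nablaDiag, nablaDiagDeriv]
  simp only [connDiag_table _ _ hg, connDiagDeriv_table _ _ _ hg]
  simp [structConst, metricVal, metricVal', metricVal'']
  field_simp
  ring

/-- With `B = 4N²A` the three directions of `SU(2)` are equivalent, so index `3` can take the role
of `2`. The coefficients are left unsimplified so that substituting `B` back reproduces
`lichMixed_one_sub_two`. -/
theorem lichMixed_one_sub_three (hN : N ≠ 0) (hA : A ≠ 0) :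
    lichMixed N A A₁ A₂ (4 * N ^ 2 * A) (4 * N ^ 2 * A₁) (4 * N ^ 2 * A₂) y y' y'' 1
      - lichMixed N A A₁ A₂ (4 * N ^ 2 * A) (4 * N ^ 2 * A₁) (4 * N ^ 2 * A₂) y y' y'' 3 =
      (4 * N ^ 2 * A) *
      (-A * (y'' 1 - y'' 3) - (A₁ + A * (4 * N ^ 2 * A₁) / (4 * N ^ 2 * A)) * (y' 1 - y' 3)
        + (1 / (N ^ 2 * A) - 2 / (4 * N ^ 2 * A)) * (y 1 - y 3)) := by
  have hg := metricVal_ne_zero hN hA (by positivity : 4 * N ^ 2 * A ≠ 0)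
  simp only [lichMixed, lichDiag, curvDiag, Fin.sum_univ_four, nablaDiag, nablaDiagDeriv]
  simp only [connDiag_table _ _ hg, connDiagDeriv_table _ _ _ hg]
  simp [structConst, metricVal, metricVal', metricVal'']
  field_simp
  ring

theorem div_metricVal (hN : N ≠ 0) (hA : A ≠ 0) (hB : B ≠ 0) :
    ∑ a, 1 / metricVal N A B a * nablaDiag (metricVal N A B) (metricVal' N A A₁ B₁)
      (fun a => metricVal N A B a * y a)
      (fun a => metricVal' N A A₁ B₁ a * y a + metricVal N A B a * y' a) a a 0 =
      y' 0 + (2 * (B₁ / (2 * B)) + A₁ / (2 * A)) * y 0 - B₁ / (2 * B) * (y 1 + y 2)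
        - A₁ / (2 * A) * y 3 := by
  simp [Fin.sum_univ_four, nablaDiag, connDiag_table _ _ (metricVal_ne_zero hN hA hB)]
  simp [metricVal, metricVal']
  field_simp
  ring

end
-- The metric functions of AdS-Taub-Nut.
/-- The function `A` of the AdS-Taub-Nut metric, with `L = ℓ⁻²`. -/
noncomputable def nutA (N L r : ℝ) : ℝ := (r - N) * (1 + L * ((r - N) * (r + 3 * N))) / (r + N)

/-- First derivative of `nutA`. -/
noncomputable def nutA' (N L r : ℝ) : ℝ :=
  2 * L * (r + N) + 2 * N * (1 - 4 * N ^ 2 * L) / (r + N) ^ 2 - 2 * N * L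

/-- Second derivative of `nutA`. -/
noncomputable def nutA'' (N L r : ℝ) : ℝ := 2 * L - 4 * N * (1 - 4 * N ^ 2 * L) / (r + N) ^ 3

/-- The values of the AdS-Taub-Nut metric on the frame. -/
noncomputable def nutVal (N L : ℝ) (a : Fin 4) (r : ℝ) : ℝ :=
  metricVal N (nutA N L r) (coeffB N r) a

/-- First radial derivative of `nutVal`. -/
noncomputable def nutVal' (N L : ℝ) (a : Fin 4) (r : ℝ) : ℝ :=
  metricVal' N (nutA N L r) (nutA' N L r) (2 * r) a

/-- Second radial derivative of `nutVal`. -/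
noncomputable def nutVal'' (N L : ℝ) (a : Fin 4) (r : ℝ) : ℝ :=
  metricVal'' N (nutA N L r) (nutA' N L r) (nutA'' N L r) 2 a

section

variable {N L ℓ r : ℝ}

theorem coeffA_eq_nutA (hN : 0 < N) (hℓ : 0 < ℓ) (r : ℝ) :
    coeffA N ℓ (N * (ℓ ^ 2 - 4 * N ^ 2) / ℓ ^ 2) r = nutA N (1 / ℓ ^ 2) r := by
  unfold coeffA nutA
  -- The nut mass makes the numerator divisible by `(r - N)²`. At `r = ±N` both sides are `0`, by a
  -- zero factor or division by zero, so the equality holds for all `r` and the metrics agree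
  -- globally.
  by_cases h1 : r - N = 0
  · obtain rfl : r = N := by linarith
    simp
  by_cases h2 : r + N = 0
  · obtain rfl : r = -N := by linarith
    simp
  have h3 : r ^ 2 - N ^ 2 ≠ 0 := by
    rw [sq_sub_sq]; exact mul_ne_zero h2 h1
  field_simp
  ring

theorem nutMetric_eq (hN : 0 < N) (hℓ : 0 < ℓ) :
    nutMetric N ℓ = radialDiag (nutVal N (1 / ℓ ^ 2)) := by
  funext a b p
  simp only [nutMetric, taubNUT, radialDiag, nutVal, metricVal, coeffA_eq_nutA hN hℓ,
    Matrix.diagonal_apply]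

theorem nutA_pos (hN : 0 < N) (hL : 0 < L) (hr : N < r) : 0 < nutA N L r := by
  have h1 : 0 < r - N := by linarith
  have h2 : 0 < r + 3 * N := by linarith
  have h3 : 0 < r + N := by linarith
  unfold nutA
  positivity

theorem coeffB_pos (hN : 0 < N) (hr : N < r) : 0 < coeffB N r := by
  unfold coeffB; nlinarith

theorem hasDerivAt_nutA (hN : 0 < N) (hr : N < r) :
    HasDerivAt (nutA N L) (nutA' N L r) r := by
  have h3 : r + N ≠ 0 := by linarith
  have h := ((((hasDerivAt_id r).sub_const N).mul (((((hasDerivAt_id r).sub_const N).mul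
    ((hasDerivAt_id r).add_const (3 * N))).const_mul L).const_add 1)).div
      ((hasDerivAt_id r).add_const N) h3)
  refine h.congr_deriv ?_
  simp only [nutA', id, Pi.mul_apply]
  field_simp
  ring

theorem hasDerivAt_nutA' (hN : 0 < N) (hr : N < r) :
    HasDerivAt (nutA' N L) (nutA'' N L r) r := by
  have h3 : r + N ≠ 0 := by linarith
  have h := (((((hasDerivAt_id r).add_const N).const_mul (2 * L)).add
    ((hasDerivAt_const r (2 * N * (1 - 4 * N ^ 2 * L))).div
      (((hasDerivAt_id r).add_const N).pow 2) (pow_ne_zero 2 h3))).sub_const (2 * N * L))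
  refine h.congr_deriv ?_
  simp only [nutA'', id, Pi.pow_apply]
  field_simp
  ring

theorem hasDerivAt_coeffB (r : ℝ) : HasDerivAt (coeffB N) (2 * r) r := by
  have h := ((hasDerivAt_id r).pow 2).sub_const (N ^ 2)
  refine h.congr_deriv ?_
  simp

theorem nutVal_pos (hN : 0 < N) (hL : 0 < L) (a : Fin 4) (hr : N < r) : 0 < nutVal N L a r := by
  have hA := nutA_pos hN hL hr
  have hB := coeffB_pos hN hr
  fin_cases a <;> simp [nutVal, metricVal] <;> positivity

theorem hasDerivAt_nutVal (hN : 0 < N) (hL : 0 < L) (a : Fin 4) (hr : N < r) :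
    HasDerivAt (nutVal N L a) (nutVal' N L a r) r := by
  have hA := nutA_pos hN hL hr
  have h1 := hasDerivAt_nutA (L := L) hN hr
  have hB := hasDerivAt_coeffB (N := N) r
  fin_cases a
  · refine ((hasDerivAt_const r (1 : ℝ)).div h1 hA.ne').congr_deriv ?_
    simp [nutVal', metricVal']
  · exact hB
  · exact hB
  · exact h1.const_mul (4 * N ^ 2)

theorem hasDerivAt_nutVal' (hN : 0 < N) (hL : 0 < L) (a : Fin 4) (hr : N < r) :
    HasDerivAt (nutVal' N L a) (nutVal'' N L a r) r := by
  have hA := nutA_pos hN hL hr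
  have h1 := hasDerivAt_nutA (L := L) hN hr
  have h2 := hasDerivAt_nutA' (L := L) hN hr
  have hB : HasDerivAt (fun r : ℝ => 2 * r) 2 r := by
    simpa using (hasDerivAt_id r).const_mul (2 : ℝ)
  fin_cases a
  · refine (h2.neg.div (h1.pow 2) (pow_ne_zero 2 hA.ne')).congr_deriv ?_
    simp [nutVal'', metricVal'']
    field_simp
    ring
  · exact hB
  · exact hB
  · exact h2.const_mul (4 * N ^ 2)

theorem contDiffOn_nutA (hN : 0 < N) {n : WithTop ℕ∞} : ContDiffOn ℝ n (nutA N L) (Ioi N) := by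
  unfold nutA
  refine ContDiffOn.div (by fun_prop) (by fun_prop) fun r hr => ?_
  have : N < r := hr
  linarith

theorem contDiffOn_coeffB {n : WithTop ℕ∞} {s : Set ℝ} : ContDiffOn ℝ n (coeffB N) s := by
  unfold coeffB; fun_prop

theorem contDiffOn_nutVal (hN : 0 < N) (hL : 0 < L) (a : Fin 4) {n : WithTop ℕ∞} :
    ContDiffOn ℝ n (nutVal N L a) (Ioi N) := by
  fin_cases a
  · exact contDiffOn_const.div (contDiffOn_nutA hN) fun r hr => (nutA_pos hN hL hr).ne'
  · exact contDiffOn_coeffB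
  · exact contDiffOn_coeffB
  · exact contDiffOn_const.mul (contDiffOn_nutA hN)

/-! ### Mixed components: field conditions and norm. -/

/-- The mixed components `h^a_a` of a diagonal invariant tensor, as functions of `r`. -/
noncomputable def mixedComp (N L : ℝ) (h : Tensor2) (a : Fin 4) (r : ℝ) : ℝ :=
  h a a (r, 1) / nutVal N L a r

theorem IsDiagonalInvariant.eq_radialDiag {h : Tensor2} (hh : IsDiagonalInvariant N h)
    (hN : 0 < N) (hL : 0 < L) (a b : Fin 4) (r : ℝ) (hr : N < r) (q : SU2) :
    h a b (r, q) = radialDiag (fun a r => nutVal N L a r * mixedComp N L h a r) a b (r, q) := by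
  by_cases hab : a = b
  · subst hab
    have h1 := hh.invariant a a r hr q 1
    rw [mul_one] at h1
    have := (nutVal_pos hN hL a hr).ne'
    simp only [radialDiag, mixedComp, if_true, h1]
    field_simp
  · simp [radialDiag, hab, hh.diagonal a b hab r hr q]

theorem IsDiagonalInvariant.contDiffOn_mixedComp {h : Tensor2} (hh : IsDiagonalInvariant N h)
    (hN : 0 < N) (hL : 0 < L) (a : Fin 4) : ContDiffOn ℝ 2 (mixedComp N L h a) (Ioi N) :=
  (hh.contDiff a a 1).div (contDiffOn_nutVal hN hL a) fun _ hr => (nutVal_pos hN hL a hr).ne'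

theorem _root_.ContDiffOn.hasDerivAt_of_two {f : ℝ → ℝ} {s : Set ℝ} (hf : ContDiffOn ℝ 2 f s)
    (hs : IsOpen s) {x : ℝ} (hx : x ∈ s) : HasDerivAt f (deriv f x) x :=
  ((hf.differentiableOn (by norm_num)).differentiableAt (hs.mem_nhds hx)).hasDerivAt

theorem _root_.ContDiffOn.hasDerivAt_deriv_of_two {f : ℝ → ℝ} {s : Set ℝ}
    (hf : ContDiffOn ℝ 2 f s) (hs : IsOpen s) {x : ℝ} (hx : x ∈ s) :
    HasDerivAt (deriv f) (deriv (deriv f) x) x := by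
  have h1 : ContDiffOn ℝ 1 (deriv f) s := by
    have h2 : ContDiffOn ℝ (1 + 1) f s := by norm_num; exact hf
    exact ((contDiffOn_succ_iff_deriv_of_isOpen hs).1 h2).2.2
  exact ((h1.differentiableOn (by norm_num)).differentiableAt (hs.mem_nhds hx)).hasDerivAt

theorem IsDiagonalInvariant.hasDerivAt_mul {h : Tensor2} (hh : IsDiagonalInvariant N h)
    (hN : 0 < N) (hL : 0 < L) (a : Fin 4) (hr : N < r) :
    HasDerivAt (fun r => nutVal N L a r * mixedComp N L h a r)
      (nutVal' N L a r * mixedComp N L h a r + nutVal N L a r * deriv (mixedComp N L h a) r) r :=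
  (hasDerivAt_nutVal hN hL a hr).mul
    ((hh.contDiffOn_mixedComp hN hL a).hasDerivAt_of_two isOpen_Ioi hr)

theorem IsDiagonalInvariant.hasDerivAt_mul' {h : Tensor2} (hh : IsDiagonalInvariant N h)
    (hN : 0 < N) (hL : 0 < L) (a : Fin 4) (hr : N < r) :
    HasDerivAt (fun r => nutVal' N L a r * mixedComp N L h a r
        + nutVal N L a r * deriv (mixedComp N L h a) r)
      (nutVal'' N L a r * mixedComp N L h a r
        + 2 * (nutVal' N L a r * deriv (mixedComp N L h a) r)
        + nutVal N L a r * deriv (deriv (mixedComp N L h a)) r) r := by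
  have h1 := (hh.contDiffOn_mixedComp hN hL a).hasDerivAt_of_two isOpen_Ioi hr
  have h2 := (hh.contDiffOn_mixedComp hN hL a).hasDerivAt_deriv_of_two isOpen_Ioi hr
  refine (((hasDerivAt_nutVal' hN hL a hr).mul h1).add
    ((hasDerivAt_nutVal hN hL a hr).mul h2)).congr_deriv ?_
  ring

theorem IsDiagonalInvariant.modLichnerowicz_eq {h : Tensor2} (hh : IsDiagonalInvariant N h)
    (hN : 0 < N) (hℓ : 0 < ℓ) (a : Fin 4) (hr : N < r) (q : SU2) :
    modLichnerowicz (nutMetric N ℓ) h a a (r, q) =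
      lichMixed N (nutA N (1 / ℓ ^ 2) r) (nutA' N (1 / ℓ ^ 2) r) (nutA'' N (1 / ℓ ^ 2) r)
        (coeffB N r) (2 * r) 2 (mixedComp N (1 / ℓ ^ 2) h · r)
        (fun a => deriv (mixedComp N (1 / ℓ ^ 2) h a) r)
        (fun a => deriv (deriv (mixedComp N (1 / ℓ ^ 2) h a)) r) a := by
  have hL : 0 < 1 / ℓ ^ 2 := by positivity
  rw [nutMetric_eq hN hℓ]
  exact modLichnerowicz_radialDiag (hh.eq_radialDiag hN hL)
    (fun a _ hs => hasDerivAt_nutVal hN hL a hs) (fun a _ hs => hasDerivAt_nutVal' hN hL a hs)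
    (fun a _ hs => (nutVal_pos hN hL a hs).ne') (fun a _ hs => hh.hasDerivAt_mul hN hL a hs)
    (fun a _ hs => hh.hasDerivAt_mul' hN hL a hs) a a hr q

theorem IsDiagonalInvariant.traceless {h : Tensor2} (hh : IsDiagonalInvariant N h)
    (hTT : IsTT (nutMetric N ℓ) N h) (hN : 0 < N) (hℓ : 0 < ℓ) (hr : N < r) :
    ∑ a, mixedComp N (1 / ℓ ^ 2) h a r = 0 := by
  have hL : 0 < 1 / ℓ ^ 2 := by positivity
  have h1 := hTT.traceless r hr 1
  rw [nutMetric_eq hN hℓ, traceT_radialDiag 1 (fun a b => hh.eq_radialDiag hN hL a b r hr 1)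
    (fun a => (nutVal_pos hN hL a hr).ne')] at h1
  rw [← h1]
  exact Finset.sum_congr rfl fun a _ => (mul_div_cancel_left₀ _ (nutVal_pos hN hL a hr).ne').symm

theorem IsDiagonalInvariant.transverse {h : Tensor2} (hh : IsDiagonalInvariant N h)
    (hTT : IsTT (nutMetric N ℓ) N h) (hN : 0 < N) (hℓ : 0 < ℓ) (hr : N < r) :
    deriv (mixedComp N (1 / ℓ ^ 2) h 0) r
      + (2 * (2 * r / (2 * coeffB N r)) + nutA' N (1 / ℓ ^ 2) r / (2 * nutA N (1 / ℓ ^ 2) r))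
        * mixedComp N (1 / ℓ ^ 2) h 0 r
      - 2 * r / (2 * coeffB N r) * (mixedComp N (1 / ℓ ^ 2) h 1 r + mixedComp N (1 / ℓ ^ 2) h 2 r)
      - nutA' N (1 / ℓ ^ 2) r / (2 * nutA N (1 / ℓ ^ 2) r) * mixedComp N (1 / ℓ ^ 2) h 3 r = 0 := by
  have hL : 0 < 1 / ℓ ^ 2 := by positivity
  have h1 := hTT.transverse 0 r hr 1
  rw [nutMetric_eq hN hℓ, divT_radialDiag (hh.eq_radialDiag hN hL)
    (fun a _ hs => hasDerivAt_nutVal hN hL a hs) (fun a _ hs => (nutVal_pos hN hL a hs).ne')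
    (fun a _ hs => hh.hasDerivAt_mul hN hL a hs) 0 hr] at h1
  rw [← h1]
  exact (div_metricVal (y := (mixedComp N (1 / ℓ ^ 2) h · r))
    (y' := fun a => deriv (mixedComp N (1 / ℓ ^ 2) h a) r)
    hN.ne' (nutA_pos hN hL hr).ne' (coeffB_pos hN hr).ne').symm

/-- By Fubini almost every slice at fixed `q` is integrable, and by invariance one slice suffices.
The factor `A` cancels in the determinant, leaving the density `√det g = 2 N B`. -/
theorem IsDiagonalInvariant.integrableOn {h : Tensor2} (hh : IsDiagonalInvariant N h)
    (hn : IsNormalisable (nutMetric N ℓ) N h) (hN : 0 < N) (hℓ : 0 < ℓ) :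
    IntegrableOn (fun r => (∑ a, mixedComp N (1 / ℓ ^ 2) h a r ^ 2) * coeffB N r) (Ioi N) := by
  have hL : 0 < 1 / ℓ ^ 2 := by positivity
  unfold IsNormalisable at hn
  rw [IntegrableOn, ← Measure.prod_restrict, Measure.restrict_univ] at hn
  obtain ⟨q, hq⟩ := hn.prod_left_ae.exists
  have h2 : IntegrableOn (fun r => (∑ a, mixedComp N (1 / ℓ ^ 2) h a r ^ 2)
      * (2 * N * coeffB N r)) (Ioi N) := by
    refine (integrableOn_congr_fun (fun r hr => ?_) measurableSet_Ioi).1 hq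
    have hA := nutA_pos hN hL hr
    have hB := coeffB_pos hN hr
    simp only [nutMetric_eq hN hℓ, normSqT_radialDiag q
      (fun a b => hh.eq_radialDiag hN hL a b r hr q) (fun a => (nutVal_pos hN hL a hr).ne'),
      det_radialDiag]
    congr 1
    · exact Finset.sum_congr rfl fun a _ => by
        rw [mul_div_cancel_left₀ _ (nutVal_pos hN hL a hr).ne']
    · have h3 : ∏ a, nutVal N (1 / ℓ ^ 2) a r = (2 * N * coeffB N r) ^ 2 := by
        simp only [Fin.prod_univ_four, nutVal]
        simp [metricVal]
        field_simp
        ring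
      rw [h3, abs_of_nonneg (sq_nonneg _), Real.sqrt_sq (by positivity)]
  refine (IntegrableOn.congr_fun (h2.const_mul (1 / (2 * N))) (fun r _ => ?_) measurableSet_Ioi)
  field_simp

end
-- Solutions of `χ'' = U χ` with `U ≥ 0`: behaviour at infinity and at the origin.
theorem not_integrableOn_of_le {f : ℝ → ℝ} {x₀ c : ℝ} (hc : 0 < c)
    (h : ∀ x, x₀ < x → c ≤ f x) : ¬ IntegrableOn f (Ioi x₀) := by
  intro hf
  have h1 : IntegrableOn (fun _ : ℝ => c) (Ioi x₀) := by
    refine Integrable.mono' hf (by fun_prop) ?_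
    filter_upwards [ae_restrict_mem measurableSet_Ioi] with x hx
    rw [Real.norm_of_nonneg hc.le]
    exact h x hx
  rw [integrableOn_const_iff] at h1
  simp [hc.ne'] at h1

section

variable {χ χ' U : ℝ → ℝ} {x₀ : ℝ}

theorem hasDerivAt_mul_deriv (h1 : ∀ x, 0 < x → HasDerivAt χ (χ' x) x)
    (h2 : ∀ x, 0 < x → HasDerivAt χ' (U x * χ x) x) {x : ℝ} (hx : 0 < x) :
    HasDerivAt (fun x => χ x * χ' x) (χ' x ^ 2 + U x * χ x ^ 2) x :=
  ((h1 x hx).mul (h2 x hx)).congr_deriv (by ring)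

theorem monotoneOn_mul_deriv (h1 : ∀ x, 0 < x → HasDerivAt χ (χ' x) x)
    (h2 : ∀ x, 0 < x → HasDerivAt χ' (U x * χ x) x) (hU : ∀ x, 0 < x → 0 ≤ U x) :
    MonotoneOn (fun x => χ x * χ' x) (Ioi 0) := by
  refine monotoneOn_of_deriv_nonneg (convex_Ioi 0)
    (fun x hx => (hasDerivAt_mul_deriv h1 h2 hx).continuousAt.continuousWithinAt) ?_ ?_
  · rw [interior_Ioi]
    exact fun x hx => (hasDerivAt_mul_deriv h1 h2 hx).differentiableAt.differentiableWithinAt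
  · rw [interior_Ioi]
    intro x hx
    rw [(hasDerivAt_mul_deriv h1 h2 hx).deriv]
    have := hU x hx
    positivity

/-- If `χ'' = U χ` with `U ≥ 0` and `χ χ' > 0` somewhere, then `χ` and `χ'` are bounded below in
absolute value further out. -/
theorem sq_le_of_growing (h1 : ∀ x, 0 < x → HasDerivAt χ (χ' x) x)
    (h2 : ∀ x, 0 < x → HasDerivAt χ' (U x * χ x) x) (hU : ∀ x, 0 < x → 0 ≤ U x)
    (hx₀ : 0 < x₀) (hpos : 0 < χ x₀ * χ' x₀) {x : ℝ} (hx : x₀ ≤ x) :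
    0 < χ x * χ' x ∧ χ x₀ ^ 2 ≤ χ x ^ 2 ∧ χ' x₀ ^ 2 ≤ χ' x ^ 2 := by
  have hu : ∀ y, x₀ ≤ y → 0 < χ y * χ' y := fun y hy =>
    hpos.trans_le (monotoneOn_mul_deriv h1 h2 hU hx₀ (hx₀.trans_le hy) hy)
  have hmono : ∀ F F' : ℝ → ℝ, (∀ y, x₀ ≤ y → HasDerivAt F (F' y) y) →
      (∀ y, x₀ ≤ y → 0 ≤ F' y) → F x₀ ≤ F x := by
    intro F F' hF hF'
    refine monotoneOn_of_deriv_nonneg (convex_Ici x₀)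
      (fun y hy => (hF y hy).continuousAt.continuousWithinAt) ?_ ?_ self_mem_Ici hx hx
    · rw [interior_Ici]
      exact fun y hy => (hF y (le_of_lt hy)).differentiableAt.differentiableWithinAt
    · rw [interior_Ici]
      intro y hy
      rw [(hF y (le_of_lt hy)).deriv]
      exact hF' y (le_of_lt hy)
  refine ⟨hu x hx, ?_, ?_⟩
  · refine hmono (fun y => χ y ^ 2) (fun y => 2 * (χ y * χ' y)) (fun y hy => ?_)
      (fun y hy => by have := hu y hy; positivity)
    exact ((h1 y (hx₀.trans_le hy)).pow 2).congr_deriv (by simp; ring)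
  · refine hmono (fun y => χ' y ^ 2) (fun y => 2 * U y * (χ y * χ' y)) (fun y hy => ?_)
      (fun y hy => by have := hu y hy; have := hU y (hx₀.trans_le hy); positivity)
    exact ((h2 y (hx₀.trans_le hy)).pow 2).congr_deriv (by simp; ring)

theorem mul_deriv_nonpos_of_integrableOn_sq (h1 : ∀ x, 0 < x → HasDerivAt χ (χ' x) x)
    (h2 : ∀ x, 0 < x → HasDerivAt χ' (U x * χ x) x) (hU : ∀ x, 0 < x → 0 ≤ U x)
    (hint : IntegrableOn (fun x => χ x ^ 2) (Ioi 0)) (hx₀ : 0 < x₀) : χ x₀ * χ' x₀ ≤ 0 := by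
  by_contra! hpos
  refine not_integrableOn_of_le (c := χ x₀ ^ 2) (x₀ := x₀) (f := fun x => χ x ^ 2) ?_
    (fun x hx => (sq_le_of_growing h1 h2 hU hx₀ hpos hx.le).2.1)
    (hint.mono_set (Ioi_subset_Ioi hx₀.le))
  have := left_ne_zero_of_mul hpos.ne'
  positivity

/-- When `χ χ' > 0` and `p ≥ 0` the cross term of the square is nonnegative, so the integrand is at
least `χ'²`, which does not decrease outwards. This handles the `00` component, for which square
integrability of `χ` at infinity is not available. -/
theorem mul_deriv_nonpos_of_integrableOn_add_sq {p : ℝ → ℝ}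
    (h1 : ∀ x, 0 < x → HasDerivAt χ (χ' x) x)
    (h2 : ∀ x, 0 < x → HasDerivAt χ' (U x * χ x) x) (hU : ∀ x, 0 < x → 0 ≤ U x)
    (hp : ∀ x, 0 < x → 0 ≤ p x)
    (hint : IntegrableOn (fun x => (χ' x + p x * χ x) ^ 2) (Ioi 0)) (hx₀ : 0 < x₀) :
    χ x₀ * χ' x₀ ≤ 0 := by
  by_contra! hpos
  refine not_integrableOn_of_le (c := χ' x₀ ^ 2) (x₀ := x₀)
    (f := fun x => (χ' x + p x * χ x) ^ 2) ?_ (fun x hx => ?_)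
    (hint.mono_set (Ioi_subset_Ioi hx₀.le))
  · have := right_ne_zero_of_mul hpos.ne'
    positivity
  · obtain ⟨ha, -, hb⟩ := sq_le_of_growing h1 h2 hU hx₀ hpos hx.le
    have hpx := hp x (hx₀.trans hx)
    nlinarith [mul_nonneg hpx ha.le, sq_nonneg (p x * χ x)]

theorem not_integrableOn_inv_sq {b : ℝ} (hb : 0 < b) :
    ¬ IntegrableOn (fun x : ℝ => 1 / x ^ 2) (Ioo 0 b) := by
  have h := (intervalIntegral.integrableOn_Ioo_rpow_iff (s := -2) hb).not.2 (by norm_num)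
  intro h'
  refine h (h'.congr_fun (fun x hx => ?_) measurableSet_Ioo)
  have hx0 : 0 < x := hx.1
  simp only
  rw [Real.rpow_neg hx0.le, Real.rpow_two, one_div]

/-- A decaying solution of `χ'' = U χ` with `U ≥ 6 x⁻²` near the origin is so singular there that
`x χ` is not square integrable. -/
theorem eq_zero_of_decaying {δ : ℝ} (h1 : ∀ x, 0 < x → HasDerivAt χ (χ' x) x)
    (h2 : ∀ x, 0 < x → HasDerivAt χ' (U x * χ x) x)
    (hδ : 0 < δ) (hUδ : ∀ x, 0 < x → x < δ → 6 / x ^ 2 ≤ U x)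
    (hdecay : ∀ x, 0 < x → χ x * χ' x ≤ 0)
    (hint : IntegrableOn (fun x => (x * χ x) ^ 2) (Ioo 0 δ)) (hx₀ : 0 < x₀) : χ x₀ = 0 := by
  -- it suffices to exclude positive values
  suffices key : ∀ f f' : ℝ → ℝ, (∀ x, 0 < x → HasDerivAt f (f' x) x) →
      (∀ x, 0 < x → HasDerivAt f' (U x * f x) x) → (∀ x, 0 < x → f x * f' x ≤ 0) →
      IntegrableOn (fun x => (x * f x) ^ 2) (Ioo 0 δ) → ¬ 0 < f x₀ by
    refine le_antisymm (not_lt.1 (key χ χ' h1 h2 hdecay hint)) ?_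
    have := key (fun x => -χ x) (fun x => -χ' x) (fun x hx => (h1 x hx).neg)
      (fun x hx => (h2 x hx).neg.congr_deriv (by ring)) (fun x hx => by
        have := hdecay x hx; linarith) (by simpa only [mul_neg, neg_sq] using hint)
    linarith
  intro f f' hf1 hf2 hdec hfint hpos
  have hanti : AntitoneOn (fun x => f x ^ 2) (Ioi 0) := by
    have hd : ∀ x : ℝ, 0 < x → HasDerivAt (fun x => f x ^ 2) (2 * (f x * f' x)) x := fun x hx =>
      ((hf1 x hx).pow 2).congr_deriv (by simp; ring)
    refine antitoneOn_of_deriv_nonpos (convex_Ioi 0)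
      (fun x hx => (hd x hx).continuousAt.continuousWithinAt) ?_ ?_
    · rw [interior_Ioi]
      exact fun x hx => (hd x hx).differentiableAt.differentiableWithinAt
    · rw [interior_Ioi]
      intro x hx
      rw [(hd x hx).deriv]
      have := hdec x hx
      linarith
  -- A zero to the left of `x₀` would force `f x₀ = 0`, since `f²` is nonincreasing.
  have hfpos : ∀ x, 0 < x → x ≤ x₀ → 0 < f x := by
    intro x hx hxx
    by_contra! hneg
    have hc : ContinuousOn f (Icc x x₀) := fun y hy =>
      (hf1 y (hx.trans_le hy.1)).continuousAt.continuousWithinAt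
    obtain ⟨z, hz, hz0⟩ := intermediate_value_Icc hxx hc ⟨hneg, hpos.le⟩
    have h := hanti (hx.trans_le hz.1) hx₀ hz.2
    simp only [hz0] at h
    nlinarith
  set x₁ := min x₀ (δ / 2) with hx₁
  have hx₁0 : 0 < x₁ := lt_min hx₀ (by linarith)
  have hx₁x : x₁ ≤ x₀ := min_le_left _ _
  have hx₁δ : x₁ < δ := (min_le_right _ _).trans_lt (by linarith)
  -- the Wronskian with `x³`
  set W : ℝ → ℝ := fun x => f' x * x ^ 3 - 3 * x ^ 2 * f x with hW
  have hWd : ∀ x, 0 < x → HasDerivAt W (x ^ 3 * f x * (U x - 6 / x ^ 2)) x := by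
    intro x hx
    have h3 : HasDerivAt (fun x : ℝ => x ^ 3) (3 * x ^ 2) x := by
      simpa using hasDerivAt_pow 3 x
    have h4 : HasDerivAt (fun x : ℝ => 3 * x ^ 2) (6 * x) x :=
      ((hasDerivAt_pow 2 x).const_mul 3).congr_deriv (by push_cast; ring)
    refine (((hf2 x hx).mul h3).sub (h4.mul (hf1 x hx))).congr_deriv ?_
    field_simp
    ring
  have hWmono : MonotoneOn W (Ioc 0 x₁) := by
    refine monotoneOn_of_deriv_nonneg (convex_Ioc 0 x₁)
      (fun x hx => (hWd x hx.1).continuousAt.continuousWithinAt) ?_ ?_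
    · rw [interior_Ioc]
      exact fun x hx => (hWd x hx.1).differentiableAt.differentiableWithinAt
    · rw [interior_Ioc]
      intro x hx
      rw [(hWd x hx.1).deriv]
      have h5 := hUδ x hx.1 (hx.2.trans hx₁δ)
      have h6 := hfpos x hx.1 (hx.2.le.trans hx₁x)
      have h7 : 0 < x := hx.1
      have h8 : 0 ≤ U x - 6 / x ^ 2 := by linarith
      positivity
  -- The comparison equation `χ'' = 6 x⁻² χ` has solutions `x³` and `x⁻²`. A strictly negative
  -- Wronskian with `x³` detects a nonzero multiple of the singular one.
  set c := -W x₁ with hc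
  have hc0 : 0 < c := by
    have h6 := hfpos x₁ hx₁0 hx₁x
    have h7 := hdec x₁ hx₁0
    have h8 : f' x₁ ≤ 0 := by
      by_contra! h9
      nlinarith
    have h9 : 0 < x₁ ^ 3 := by positivity
    have h10 : 0 < x₁ ^ 2 * f x₁ := by positivity
    simp only [hc, hW]
    nlinarith
  have hWle : ∀ x, 0 < x → x ≤ x₁ → W x ≤ -c := fun x hx hxx => by
    rw [hc, neg_neg]
    exact hWmono ⟨hx, hxx⟩ ⟨hx₁0, le_rfl⟩ hxx
  -- Since `(f / x³)' = W / x⁶ ≤ -c / x⁶`, subtracting the antiderivative `(c/5) x⁻⁵` of `-c / x⁶`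
  -- leaves a nonincreasing function. Its value at `x₁` bounds `f` from below by about `(c/5) x⁻²`.
  set z : ℝ → ℝ := fun x => f x / x ^ 3 - c / 5 / x ^ 5 with hz
  have hzd : ∀ x, 0 < x → HasDerivAt z ((W x + c) / x ^ 6) x := by
    intro x hx
    have h3 : HasDerivAt (fun x : ℝ => x ^ 3) (3 * x ^ 2) x := by
      simpa using hasDerivAt_pow 3 x
    have h4 : HasDerivAt (fun x : ℝ => x ^ 5) (5 * x ^ 4) x := by
      simpa using hasDerivAt_pow 5 x
    refine (((hf1 x hx).div h3 (by positivity)).sub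
      ((hasDerivAt_const x (c / 5)).div h4 (by positivity))).congr_deriv ?_
    simp only [hW]
    field_simp
    ring
  have hzanti : AntitoneOn z (Ioc 0 x₁) := by
    refine antitoneOn_of_deriv_nonpos (convex_Ioc 0 x₁)
      (fun x hx => (hzd x hx.1).continuousAt.continuousWithinAt) ?_ ?_
    · rw [interior_Ioc]
      exact fun x hx => (hzd x hx.1).differentiableAt.differentiableWithinAt
    · rw [interior_Ioc]
      intro x hx
      rw [(hzd x hx.1).deriv]
      have h3 := hWle x hx.1 hx.2.le
      have h4 : 0 < x := hx.1
      exact div_nonpos_of_nonpos_of_nonneg (by linarith) (by positivity)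
  -- hence `x² f` is bounded below near the origin
  have hlow : ∀ x, 0 < x → x ≤ x₁ → c / 5 - |z x₁| * x ^ 5 ≤ x ^ 2 * f x := by
    intro x hx hxx
    have h3 : z x₁ ≤ z x := hzanti ⟨hx, hxx⟩ ⟨hx₁0, le_rfl⟩ hxx
    have h4 : z x * x ^ 5 = x ^ 2 * f x - c / 5 := by
      simp only [hz]; field_simp
    have h5 : 0 < x ^ 5 := by positivity
    nlinarith [neg_abs_le (z x₁), mul_le_mul_of_nonneg_right h3 h5.le,
      mul_le_mul_of_nonneg_right (neg_abs_le (z x₁)) h5.le]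
  have hcont : Filter.Tendsto (fun x : ℝ => c / 5 - |z x₁| * x ^ 5) (nhds 0) (nhds (c / 5)) := by
    have : Continuous fun x : ℝ => c / 5 - |z x₁| * x ^ 5 := by fun_prop
    simpa using this.tendsto 0
  obtain ⟨ε, hε, hball⟩ := Metric.eventually_nhds_iff.1
    (hcont.eventually (lt_mem_nhds (by linarith : c / 10 < c / 5)))
  set b := min ε x₁ with hb
  have hb0 : 0 < b := lt_min hε hx₁0
  have hbound : ∀ x ∈ Ioo 0 b, (c / 10) ^ 2 * (1 / x ^ 2) ≤ (x * f x) ^ 2 := by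
    intro x hx
    have hx0 : 0 < x := hx.1
    have h3 := hball (y := x) (by
      rw [Real.dist_eq, sub_zero, abs_of_pos hx0]; exact hx.2.trans_le (min_le_left _ _))
    have h4 := hlow x hx0 (hx.2.le.trans (min_le_right _ _))
    have h5 : (c / 10) ^ 2 ≤ (x ^ 2 * f x) ^ 2 := by
      refine pow_le_pow_left₀ (by positivity) (by linarith) 2
    rw [mul_one_div, div_le_iff₀ (by positivity)]
    calc (c / 10) ^ 2 ≤ _ := h5
      _ = _ := by ring
  have h6 : IntegrableOn (fun x : ℝ => (c / 10) ^ 2 * (1 / x ^ 2)) (Ioo 0 b) := by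
    refine Integrable.mono' (hfint.mono_set
      (Ioo_subset_Ioo_right ((min_le_right _ _).trans hx₁δ.le)))
      (by measurability) ?_
    filter_upwards [ae_restrict_mem measurableSet_Ioo] with x hx
    rw [Real.norm_of_nonneg (by positivity)]
    exact hbound x hx
  refine not_integrableOn_inv_sq hb0 (IntegrableOn.congr_fun (h6.const_mul (1 / (c / 10) ^ 2))
    (fun x _ => ?_) measurableSet_Ioo)
  field_simp

end
-- The proper distance from the nut and its inverse.
/-- The integrand of the proper distance from the nut, in the variable `s = √(r - N)`. -/
noncomputable def distDensity (N L s : ℝ) : ℝ :=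
  2 * √((s ^ 2 + 2 * N) / (1 + L * (s ^ 2 * (s ^ 2 + 4 * N))))

/-- The proper distance from the nut, as a function of `s = √(r - N)`. -/
noncomputable def distAux (N L y : ℝ) : ℝ := ∫ s in (0 : ℝ)..y, distDensity N L s

/-- The proper distance `∫ dr / √A` from the nut. -/
noncomputable def nutDist (N L r : ℝ) : ℝ := distAux N L √(r - N)

section

variable {N L r : ℝ}

theorem continuous_distDensity (hN : 0 < N) (hL : 0 < L) : Continuous (distDensity N L) := by
  unfold distDensity
  refine continuous_const.mul (Real.continuous_sqrt.comp (Continuous.div (by fun_prop)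
    (by fun_prop) fun s => ?_))
  positivity

theorem distDensity_pos (hN : 0 < N) (hL : 0 < L) (s : ℝ) : 0 < distDensity N L s := by
  unfold distDensity; positivity

theorem hasDerivAt_distAux (hN : 0 < N) (hL : 0 < L) (y : ℝ) :
    HasDerivAt (distAux N L) (distDensity N L y) y :=
  intervalIntegral.integral_hasDerivAt_right
    ((continuous_distDensity hN hL).intervalIntegrable _ _)
    ((continuous_distDensity hN hL).stronglyMeasurableAtFilter _ _)
    (continuous_distDensity hN hL).continuousAt

@[simp] theorem distAux_zero : distAux N L 0 = 0 := by simp [distAux]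

theorem strictMono_distAux (hN : 0 < N) (hL : 0 < L) : StrictMono (distAux N L) :=
  strictMono_of_deriv_pos fun y => by
    rw [(hasDerivAt_distAux hN hL y).deriv]; exact distDensity_pos hN hL y

/-- The density decays only like `1 / s`, so the distance diverges logarithmically; this is why
`r_*` exhausts the whole half-line. -/
theorem tendsto_distAux (hN : 0 < N) (hL : 0 < L) :
    Filter.Tendsto (distAux N L) Filter.atTop Filter.atTop := by
  -- comparison with a logarithm
  obtain ⟨c, hc, hbound⟩ : ∃ c : ℝ, 0 < c ∧ ∀ s, 0 ≤ s → c / (1 + s) ≤ distDensity N L s := by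
    -- The constant comes from `1 + L s²(s² + 4N) ≤ (s² + 2N)(1/(2N) + 2L)(1 + s)²`.
    refine ⟨2 * √(1 / (1 / (2 * N) + 2 * L)), by positivity, fun s hs => ?_⟩
    have h1 : 1 / (1 + s) = √(1 / (1 + s) ^ 2) := by
      rw [← one_div_pow, Real.sqrt_sq (by positivity)]
    rw [distDensity, div_eq_mul_one_div, h1, mul_assoc, ← Real.sqrt_mul (by positivity)]
    gcongr
    rw [div_mul_div_comm, div_le_div_iff₀ (by positivity) (by positivity), one_mul, one_mul]
    have e1 : 1 ≤ (s ^ 2 + 2 * N) * (1 / (2 * N)) := by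
      have : (s ^ 2 + 2 * N) * (1 / (2 * N)) = s ^ 2 / (2 * N) + 1 := by field_simp
      rw [this]
      have : 0 ≤ s ^ 2 / (2 * N) := by positivity
      linarith
    have e2 : (1 : ℝ) ≤ (1 + s) ^ 2 := by nlinarith
    have e3 : s ^ 2 ≤ (1 + s) ^ 2 := by nlinarith
    have e4 : s ^ 2 + 4 * N ≤ 2 * (s ^ 2 + 2 * N) := by nlinarith [sq_nonneg s]
    calc 1 + L * (s ^ 2 * (s ^ 2 + 4 * N))
        ≤ (s ^ 2 + 2 * N) * (1 / (2 * N)) * (1 + s) ^ 2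
          + L * ((1 + s) ^ 2 * (2 * (s ^ 2 + 2 * N))) := by
          gcongr
          exact one_le_mul_of_one_le_of_one_le e1 e2
      _ = _ := by ring
  have hlog : Filter.Tendsto (fun y : ℝ => c * Real.log (1 + y)) Filter.atTop Filter.atTop :=
    (Real.tendsto_log_atTop.comp (Filter.tendsto_atTop_add_const_left _ 1 Filter.tendsto_id)
      ).const_mul_atTop hc
  refine Filter.tendsto_atTop_mono' _ ?_ hlog
  filter_upwards [Filter.eventually_ge_atTop 0] with y hy
  have hd : ∀ s : ℝ, 0 ≤ s → HasDerivAt (fun y => distAux N L y - c * Real.log (1 + y))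
      (distDensity N L s - c / (1 + s)) s := by
    intro s hs
    have h1 : HasDerivAt (fun y : ℝ => 1 + y) 1 s := (hasDerivAt_id s).const_add 1
    refine ((hasDerivAt_distAux hN hL s).sub
      ((h1.log (by positivity)).const_mul c)).congr_deriv ?_
    ring
  have hm : MonotoneOn (fun y => distAux N L y - c * Real.log (1 + y)) (Ici 0) := by
    refine monotoneOn_of_deriv_nonneg (convex_Ici 0)
      (fun s hs => (hd s hs).continuousAt.continuousWithinAt) ?_ ?_
    · rw [interior_Ici]
      exact fun s hs => (hd s (le_of_lt hs)).differentiableAt.differentiableWithinAt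
    · rw [interior_Ici]
      intro s hs
      rw [(hd s (le_of_lt hs)).deriv]
      linarith [hbound s (le_of_lt hs)]
  have := hm self_mem_Ici hy hy
  simp at this
  exact this

theorem hasDerivAt_nutDist (hN : 0 < N) (hL : 0 < L) (hr : N < r) :
    HasDerivAt (nutDist N L) (1 / √(nutA N L r)) r := by
  have ht : 0 < r - N := by linarith
  have h1 : HasDerivAt (fun r => √(r - N)) (1 / (2 * √(r - N))) r :=
    ((hasDerivAt_id r).sub_const N).sqrt ht.ne'
  refine ((hasDerivAt_distAux hN hL √(r - N)).comp r h1).congr_deriv ?_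
  have h2 : nutA N L r = (r - N) / ((r + N) / (1 + L * ((r - N) * (r + 3 * N)))) := by
    unfold nutA; field_simp
  rw [h2, Real.sqrt_div ht.le, distDensity, Real.sq_sqrt ht.le,
    show r - N + 2 * N = r + N by ring, show r - N + 4 * N = r + 3 * N by ring]
  field_simp

theorem bijOn_nutDist (hN : 0 < N) (hL : 0 < L) : BijOn (nutDist N L) (Ioi N) (Ioi 0) := by
  refine ⟨fun r hr => ?_, fun r hr s hs hrs => ?_, fun x hx => ?_⟩
  · have h : (0 : ℝ) < √(r - N) := Real.sqrt_pos.2 (sub_pos.2 hr)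
    simpa [nutDist] using strictMono_distAux hN hL h
  · have h := (strictMono_distAux hN hL).injective hrs
    have h2 := (Real.sqrt_inj (sub_pos.2 hr).le (sub_pos.2 hs).le).1 h
    linarith
  · have hc : Continuous (distAux N L) := continuous_iff_continuousAt.2 fun y =>
      (hasDerivAt_distAux hN hL y).continuousAt
    obtain ⟨y₁, hy₁, hy₁'⟩ :=
      (((tendsto_distAux hN hL).eventually_gt_atTop x).and (Filter.eventually_gt_atTop 0)).exists
    obtain ⟨y, hy, rfl⟩ := intermediate_value_Icc hy₁'.le hc.continuousOn
      (show x ∈ Icc (distAux N L 0) (distAux N L y₁) by simpa using ⟨le_of_lt hx, hy₁.le⟩)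
    have hy0 : 0 < y := (strictMono_distAux hN hL).lt_iff_lt.1 (by simpa using hx)
    refine ⟨N + y ^ 2, by simp; positivity, ?_⟩
    simp [nutDist, Real.sqrt_sq hy0.le]

/-- Near the nut, the square of the proper distance is close to `8 N (r - N)`. -/
theorem exists_nutDist_bounds (hN : 0 < N) (hL : 0 < L) :
    ∃ ε > 0, ∀ r, N < r → r < N + ε →
      7 * N * (r - N) ≤ nutDist N L r ^ 2 ∧ nutDist N L r ^ 2 ≤ 9 * N * (r - N) := by
  have h0 : distDensity N L 0 = √(8 * N) := by
    rw [show (8 * N : ℝ) = 2 ^ 2 * (2 * N) by ring, Real.sqrt_mul (by positivity) (2 * N),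
      Real.sqrt_sq (by norm_num)]
    simp [distDensity]
  have hd : HasDerivAt (distAux N L) √(8 * N) 0 := h0 ▸ hasDerivAt_distAux hN hL 0
  have hslope := hd.tendsto_slope_zero
  -- The slope of the distance in `s = √(r - N)` at `0` is `√(8N)`; `7` and `9` merely bracket `8`.
  have h7 : √(7 * N) < √(8 * N) := Real.sqrt_lt_sqrt (by positivity) (by linarith)
  have h9 : √(8 * N) < √(9 * N) := Real.sqrt_lt_sqrt (by positivity) (by linarith)
  have hev := (hslope.eventually (lt_mem_nhds h7)).and (hslope.eventually (gt_mem_nhds h9))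
  rw [eventually_nhdsWithin_iff] at hev
  obtain ⟨ε, hε, hball⟩ := Metric.eventually_nhds_iff.1 hev
  refine ⟨ε ^ 2, by positivity, fun r hr hrε => ?_⟩
  have ht : 0 < r - N := sub_pos.2 hr
  have hy : 0 < √(r - N) := Real.sqrt_pos.2 ht
  have hyε : √(r - N) < ε := (Real.sqrt_lt' hε).2 (by linarith)
  obtain ⟨ha, hb⟩ := hball (y := √(r - N)) (by
    rw [Real.dist_eq, sub_zero, abs_of_pos hy]; exact hyε) hy.ne'
  simp only [zero_add, distAux_zero, sub_zero, smul_eq_mul] at ha hb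
  rw [inv_mul_eq_div, lt_div_iff₀ hy] at ha
  rw [inv_mul_eq_div, div_lt_iff₀ hy] at hb
  constructor
  · have := pow_le_pow_left₀ (by positivity) ha.le 2
    rwa [mul_pow, Real.sq_sqrt (by positivity), Real.sq_sqrt ht.le] at this
  · have h0 : 0 ≤ distAux N L √(r - N) := le_trans (by positivity) ha.le
    have := pow_le_pow_left₀ h0 hb.le 2
    rwa [mul_pow, Real.sq_sqrt (by positivity), Real.sq_sqrt ht.le] at this

/-- The radius as a function of the proper distance. -/
noncomputable def nutRadius (N L : ℝ) : ℝ → ℝ := Function.invFunOn (nutDist N L) (Ioi N)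

theorem nutRadius_mem (hN : 0 < N) (hL : 0 < L) {x : ℝ} (hx : 0 < x) : N < nutRadius N L x :=
  Function.invFunOn_mem ((bijOn_nutDist hN hL).surjOn hx)

theorem nutDist_nutRadius (hN : 0 < N) (hL : 0 < L) {x : ℝ} (hx : 0 < x) :
    nutDist N L (nutRadius N L x) = x :=
  Function.invFunOn_eq ((bijOn_nutDist hN hL).surjOn hx)

theorem nutRadius_nutDist (hN : 0 < N) (hL : 0 < L) (hr : N < r) :
    nutRadius N L (nutDist N L r) = r :=
  (bijOn_nutDist hN hL).injOn.leftInvOn_invFunOn hr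

theorem nutDist_pos (hN : 0 < N) (hL : 0 < L) (hr : N < r) : 0 < nutDist N L r :=
  (bijOn_nutDist hN hL).mapsTo hr

theorem strictMonoOn_nutDist (hN : 0 < N) (hL : 0 < L) : StrictMonoOn (nutDist N L) (Ioi N) :=
  fun _ hr _ _ hrs => strictMono_distAux hN hL
    (Real.sqrt_lt_sqrt (sub_pos.2 hr).le (by linarith))

theorem hasDerivAt_nutRadius (hN : 0 < N) (hL : 0 < L) {x : ℝ} (hx : 0 < x) :
    HasDerivAt (nutRadius N L) √(nutA N L (nutRadius N L x)) x := by
  have hr := nutRadius_mem hN hL hx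
  have hA := nutA_pos hN hL hr
  have hmono : MonotoneOn (nutRadius N L) (Ioi 0) := by
    intro a ha b hb hab
    by_contra! hlt
    have := strictMonoOn_nutDist hN hL (nutRadius_mem hN hL hb) (nutRadius_mem hN hL ha) hlt
    rw [nutDist_nutRadius hN hL ha, nutDist_nutRadius hN hL hb] at this
    exact absurd this (not_lt.2 hab)
  have himage : nutRadius N L '' Ioi 0 ∈ nhds (nutRadius N L x) := by
    refine Filter.mem_of_superset (Ioi_mem_nhds hr) fun r hr' => ?_
    exact ⟨nutDist N L r, nutDist_pos hN hL hr', nutRadius_nutDist hN hL hr'⟩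
  have hc := continuousAt_of_monotoneOn_of_image_mem_nhds hmono (Ioi_mem_nhds hx) himage
  have h := HasDerivAt.of_local_left_inverse hc (hasDerivAt_nutDist hN hL hr)
    (one_div_pos.2 (Real.sqrt_pos.2 hA)).ne' (by
      filter_upwards [Ioi_mem_nhds hx] with y hy using nutDist_nutRadius hN hL hy)
  simpa using h

theorem contDiffOn_sqrt_nutA (hN : 0 < N) (hL : 0 < L) {n : WithTop ℕ∞} :
    ContDiffOn ℝ n (fun r => √(nutA N L r)) (Ioi N) :=
  (contDiffOn_nutA hN).sqrt fun _ hr => (nutA_pos hN hL hr).ne'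

/-- Bootstrap on the autonomous equation `ρ' = √(A(ρ))`: each order of smoothness of `ρ` gives one
more for `ρ'`. -/
theorem contDiffOn_nutRadius (hN : 0 < N) (hL : 0 < L) :
    ContDiffOn ℝ ∞ (nutRadius N L) (Ioi 0) := by
  refine contDiffOn_infty.2 fun n => ?_
  induction n with
  | zero =>
    exact contDiffOn_zero.2 fun x hx =>
      (hasDerivAt_nutRadius hN hL hx).continuousAt.continuousWithinAt
  | succ n ih =>
    push_cast
    refine (contDiffOn_succ_iff_deriv_of_isOpen isOpen_Ioi).2 ⟨fun x hx =>
      (hasDerivAt_nutRadius hN hL hx).differentiableAt.differentiableWithinAt, by simp, ?_⟩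
    refine ContDiffOn.congr ((contDiffOn_sqrt_nutA hN hL).comp ih
      fun x hx => nutRadius_mem hN hL hx) fun x hx => ?_
    exact (hasDerivAt_nutRadius hN hL hx).deriv

/-- Change of variables to the proper distance. -/
theorem integrableOn_comp_nutDist_iff (hN : 0 < N) (hL : 0 < L) (F : ℝ → ℝ) :
    IntegrableOn F (Ioi 0) ↔
      IntegrableOn (fun r => 1 / √(nutA N L r) * F (nutDist N L r)) (Ioi N) := by
  have h := integrableOn_image_iff_integrableOn_abs_deriv_smul (measurableSet_Ioi (a := N))
    (fun r hr => (hasDerivAt_nutDist hN hL hr).hasDerivWithinAt) (bijOn_nutDist hN hL).injOn F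
  rw [(bijOn_nutDist hN hL).image_eq] at h
  rw [h]
  refine integrableOn_congr_fun (fun r _ => ?_) measurableSet_Ioi
  simp only [smul_eq_mul]
  rw [abs_of_nonneg (by positivity)]

end
-- Weights and potentials.
/-- The factor `E = 1 + L (r - N) (r + 3N)` of `A`. -/
noncomputable def nutE (N L r : ℝ) : ℝ := 1 + L * ((r - N) * (r + 3 * N))

/-- The weight `(r - N) ^ a * (r + N) ^ b * E ^ c`. -/
noncomputable def nutWeight (N L a b c r : ℝ) : ℝ :=
  Real.exp (a * Real.log (r - N) + b * Real.log (r + N) + c * Real.log (nutE N L r))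

/-- The logarithmic derivative of `nutWeight`. -/
noncomputable def nutLogDeriv (N L a b c r : ℝ) : ℝ :=
  a / (r - N) + b / (r + N) + c * (2 * L * (r + N)) / nutE N L r

/-- The derivative of `nutLogDeriv`. -/
noncomputable def nutLogDeriv' (N L a b c r : ℝ) : ℝ :=
  -a / (r - N) ^ 2 - b / (r + N) ^ 2
    + c * (2 * L * (nutE N L r - 2 * L * (r + N) ^ 2)) / nutE N L r ^ 2

/-- The potential for the difference of the `11` and `22` components. -/
noncomputable def potDiff (N L r : ℝ) : ℝ :=
  (35 / 4 * N ^ 4 + 25 * (r - N) * N ^ 3 + 22 * (r - N) ^ 2 * N ^ 2 + 8 * (r - N) ^ 3 * N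
      + (r - N) ^ 4
    + L * (-12 * (r - N) * N ^ 5 - 13 / 2 * (r - N) ^ 2 * N ^ 4 - 1 / 2 * (r - N) ^ 3 * N ^ 3
      + 1 / 2 * (r - N) ^ 4 * N ^ 2)
    + L ^ 2 * (64 * (r - N) ^ 2 * N ^ 6 + 124 * (r - N) ^ 3 * N ^ 5 + 323 / 4 * (r - N) ^ 4 * N ^ 4
      + 45 / 2 * (r - N) ^ 5 * N ^ 3 + 9 / 4 * (r - N) ^ 6 * N ^ 2))
    / (N ^ 2 * (r + N) ^ 3 * nutE N L r) / (r - N)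

/-- The potential for the `00` component. -/
noncomputable def potRadial (N L r : ℝ) : ℝ :=
  (63 / 4 * N ^ 2 + 11 * (r - N) * N + 2 * (r - N) ^ 2
    + L * (124 * (r - N) * N ^ 3 + 231 / 2 * (r - N) ^ 2 * N ^ 2 + 71 / 2 * (r - N) ^ 3 * N
      + 7 / 2 * (r - N) ^ 4)
    + L ^ 2 * (256 * (r - N) ^ 2 * N ^ 4 + 308 * (r - N) ^ 3 * N ^ 3 + 559 / 4 * (r - N) ^ 4 * N ^ 2
      + 57 / 2 * (r - N) ^ 5 * N + 9 / 4 * (r - N) ^ 6))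
    / ((r + N) ^ 3 * nutE N L r) / (r - N)

section

variable {N L r a b c : ℝ}

theorem nutE_pos (hN : 0 < N) (hL : 0 < L) (hr : N ≤ r) : 0 < nutE N L r := by
  have h1 : 0 ≤ r - N := by linarith
  have h2 : 0 < r + 3 * N := by linarith
  unfold nutE
  positivity

theorem hasDerivAt_nutE (r : ℝ) : HasDerivAt (nutE N L) (2 * L * (r + N)) r := by
  have h := ((((hasDerivAt_id r).sub_const N).mul
    ((hasDerivAt_id r).add_const (3 * N))).const_mul L).const_add 1
  refine h.congr_deriv ?_
  simp
  ring

theorem continuous_nutE : Continuous (nutE N L) := by unfold nutE; fun_prop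

theorem contDiff_nutE {n : WithTop ℕ∞} : ContDiff ℝ n (nutE N L) := by unfold nutE; fun_prop

theorem nutWeight_pos : 0 < nutWeight N L a b c r := Real.exp_pos _

theorem hasDerivAt_nutWeight (hN : 0 < N) (hL : 0 < L) (hr : N < r) :
    HasDerivAt (nutWeight N L a b c) (nutLogDeriv N L a b c r * nutWeight N L a b c r) r := by
  have hE := nutE_pos hN hL hr.le
  have h1 : r - N ≠ 0 := by linarith
  have h2 : r + N ≠ 0 := by linarith
  refine ((((((hasDerivAt_id r).sub_const N).log h1).const_mul a).add
    ((((hasDerivAt_id r).add_const N).log h2).const_mul b)).add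
    (((hasDerivAt_nutE r).log hE.ne').const_mul c)).exp.congr_deriv ?_
  simp only [nutLogDeriv, nutWeight, id, Pi.add_apply]
  ring

theorem hasDerivAt_nutLogDeriv (hN : 0 < N) (hL : 0 < L) (hr : N < r) :
    HasDerivAt (nutLogDeriv N L a b c) (nutLogDeriv' N L a b c r) r := by
  have hE := nutE_pos hN hL hr.le
  have h1 : r - N ≠ 0 := by linarith
  have h2 : r + N ≠ 0 := by linarith
  refine ((((hasDerivAt_const r a).div ((hasDerivAt_id r).sub_const N) h1).add
    ((hasDerivAt_const r b).div ((hasDerivAt_id r).add_const N) h2)).add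
    (((((hasDerivAt_id r).add_const N).const_mul (2 * L)).const_mul c).div
      (hasDerivAt_nutE r) hE.ne')).congr_deriv ?_
  simp only [nutLogDeriv', id]
  field_simp
  ring

theorem contDiffOn_nutWeight (hN : 0 < N) (hL : 0 < L) {n : WithTop ℕ∞} :
    ContDiffOn ℝ n (nutWeight N L a b c) (Ioi N) := by
  unfold nutWeight
  refine ContDiffOn.exp (((contDiffOn_const.mul (ContDiffOn.log (by fun_prop) ?_)).add
    (contDiffOn_const.mul (ContDiffOn.log (by fun_prop) ?_))).add
    (contDiffOn_const.mul (ContDiffOn.log contDiff_nutE.contDiffOn ?_)))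
  · exact fun r hr => (sub_pos.2 hr).ne'
  · exact fun r hr => (add_pos (hN.trans hr) hN).ne'
  · exact fun r hr => (nutE_pos hN hL (le_of_lt hr)).ne'

theorem nutA_eq_nutE : nutA N L r = (r - N) * nutE N L r / (r + N) := rfl

/-- This is the density of the norm in the new variable: if `y = w χ(r_*)`, then `y² B dr = w² B √A
χ² dr_*`. -/
theorem nutWeight_sq_mul (hN : 0 < N) (hL : 0 < L) (hr : N < r) :
    nutWeight N L a b c r ^ 2 * coeffB N r * √(nutA N L r) =
      Real.exp ((2 * a + 3 / 2) * Real.log (r - N) + (2 * b + 1 / 2) * Real.log (r + N)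
        + (2 * c + 1 / 2) * Real.log (nutE N L r)) := by
  have hE := nutE_pos hN hL hr.le
  have h1 : 0 < r - N := by linarith
  have h2 : 0 < r + N := by linarith
  have hB : coeffB N r = Real.exp (Real.log (r - N) + Real.log (r + N)) := by
    rw [Real.exp_add, Real.exp_log h1, Real.exp_log h2, coeffB]; ring
  have hA : √(nutA N L r) =
      Real.exp ((Real.log (r - N) + Real.log (nutE N L r) - Real.log (r + N)) / 2) := by
    rw [Real.exp_half, Real.exp_sub, Real.exp_add, Real.exp_log h1, Real.exp_log h2,
      Real.exp_log hE]
    rfl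
  rw [hB, hA, nutWeight, ← Real.exp_nat_mul, ← Real.exp_add, ← Real.exp_add]
  congr 1
  push_cast
  ring

/-- In powers of `t = r - N` the only negative terms are linear in `L`. Grouped with terms of orders
`L⁰` and `L²`, each becomes a quadratic in `L t N` that is positive by completing the square. -/
theorem potDiff_pos (hN : 0 < N) (hL : 0 < L) (hr : N < r) : 0 < potDiff N L r := by
  have hE := nutE_pos hN hL hr.le
  obtain ⟨t, ht, rfl⟩ : ∃ t, 0 < t ∧ r = N + t := ⟨r - N, by linarith, by ring⟩
  unfold potDiff
  simp only [add_sub_cancel_left]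
  refine div_pos (div_pos ?_ (by positivity)) ht
  have e1 : 0 < 35 / 4 * N ^ 4 - 12 * L * t * N ^ 5 + 64 * L ^ 2 * t ^ 2 * N ^ 6 := by
    have : 35 / 4 * N ^ 4 - 12 * L * t * N ^ 5 + 64 * L ^ 2 * t ^ 2 * N ^ 6 =
      N ^ 4 * ((8 * (L * t * N) - 3 / 4) ^ 2 + 131 / 16) := by ring
    rw [this]
    positivity
  have e2 : 0 < t * N ^ 3 * (25 - 13 / 2 * (L * t * N) + 124 * (L * t * N) ^ 2) := by
    have : 25 - 13 / 2 * (L * t * N) + 124 * (L * t * N) ^ 2 =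
      (L * t * N - 13 / 4) ^ 2 + 123 * (L * t * N) ^ 2 + 231 / 16 := by ring
    rw [this]
    positivity
  have e3 : 0 < t ^ 2 * N ^ 2 * (22 - 1 / 2 * (L * t * N) + 323 / 4 * (L * t * N) ^ 2) := by
    have : 22 - 1 / 2 * (L * t * N) + 323 / 4 * (L * t * N) ^ 2 =
      (L * t * N - 1 / 4) ^ 2 + 319 / 4 * (L * t * N) ^ 2 + 351 / 16 := by ring
    rw [this]
    positivity
  have e4 : 0 < 8 * t ^ 3 * N + t ^ 4 + L * (1 / 2 * t ^ 4 * N ^ 2)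
      + L ^ 2 * (45 / 2 * t ^ 5 * N ^ 3 + 9 / 4 * t ^ 6 * N ^ 2) := by positivity
  linarith

theorem potRadial_pos (hN : 0 < N) (hL : 0 < L) (hr : N < r) : 0 < potRadial N L r := by
  have hE := nutE_pos hN hL hr.le
  obtain ⟨t, ht, rfl⟩ : ∃ t, 0 < t ∧ r = N + t := ⟨r - N, by linarith, by ring⟩
  unfold potRadial
  simp only [add_sub_cancel_left]
  positivity

theorem contDiffOn_potDiff (hN : 0 < N) (hL : 0 < L) {n : WithTop ℕ∞} :
    ContDiffOn ℝ n (potDiff N L) (Ioi N) := by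
  have hE : ContDiff ℝ n (nutE N L) := contDiff_nutE
  unfold potDiff
  refine ContDiffOn.div (ContDiffOn.div (by fun_prop) (by fun_prop) fun r hr => ?_)
    (by fun_prop) fun r hr => (sub_pos.2 hr).ne'
  have h1 := nutE_pos hN hL (le_of_lt hr)
  have h2 : 0 < r + N := add_pos (hN.trans hr) hN
  positivity

theorem contDiffOn_potRadial (hN : 0 < N) (hL : 0 < L) {n : WithTop ℕ∞} :
    ContDiffOn ℝ n (potRadial N L) (Ioi N) := by
  have hE : ContDiff ℝ n (nutE N L) := contDiff_nutE
  unfold potRadial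
  refine ContDiffOn.div (ContDiffOn.div (by fun_prop) (by fun_prop) fun r hr => ?_)
    (by fun_prop) fun r hr => (sub_pos.2 hr).ne'
  have h1 := nutE_pos hN hL (le_of_lt hr)
  have h2 : 0 < r + N := add_pos (hN.trans hr) hN
  positivity

/-- The limit of `(r - N) V` at the nut is `35 / (32 N)`, which exceeds `6 / (7 N)`. In proper
distance `x² ≈ 8N (r - N)` this is `V ≈ (35/4) x⁻²`, so the bound `6 x⁻²` has room to spare. -/
theorem eventually_le_potDiff (hN : 0 < N) (hL : 0 < L) :
    ∀ᶠ r in nhdsWithin N (Ioi N), 6 / (7 * N * (r - N)) ≤ potDiff N L r := by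
  have hE := nutE_pos hN hL le_rfl
  have hEc := continuous_nutE (N := N) (L := L)
  set G : ℝ → ℝ := fun r => (35 / 4 * N ^ 4 + 25 * (r - N) * N ^ 3 + 22 * (r - N) ^ 2 * N ^ 2
      + 8 * (r - N) ^ 3 * N + (r - N) ^ 4
    + L * (-12 * (r - N) * N ^ 5 - 13 / 2 * (r - N) ^ 2 * N ^ 4 - 1 / 2 * (r - N) ^ 3 * N ^ 3
      + 1 / 2 * (r - N) ^ 4 * N ^ 2)
    + L ^ 2 * (64 * (r - N) ^ 2 * N ^ 6 + 124 * (r - N) ^ 3 * N ^ 5 + 323 / 4 * (r - N) ^ 4 * N ^ 4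
      + 45 / 2 * (r - N) ^ 5 * N ^ 3 + 9 / 4 * (r - N) ^ 6 * N ^ 2))
    / (N ^ 2 * (r + N) ^ 3 * nutE N L r) with hG
  have hGc : ContinuousAt G N :=
    ContinuousAt.div (by fun_prop) (by fun_prop) (by positivity)
  have hGN : 6 / (7 * N) < G N := by
    have h1 : nutE N L N = 1 := by simp [nutE]
    have : G N = 35 / 32 * (1 / N) := by
      simp only [hG, h1]; field_simp; ring
    rw [this, div_eq_mul_one_div, ← one_div_mul_one_div]
    have : 0 < 1 / N := by positivity
    linarith
  have hev := hGc.eventually (lt_mem_nhds hGN)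
  filter_upwards [nhdsWithin_le_nhds hev, self_mem_nhdsWithin] with r h1 hr
  have ht : 0 < r - N := sub_pos.2 hr
  rw [← div_div]
  exact (div_le_div_iff_of_pos_right ht).2 h1.le

/-- Here the limit of `(r - N) V` is `63 / (32 N)`, that is `V ≈ (63/4) x⁻²` in proper distance. -/
theorem eventually_le_potRadial (hN : 0 < N) (hL : 0 < L) :
    ∀ᶠ r in nhdsWithin N (Ioi N), 6 / (7 * N * (r - N)) ≤ potRadial N L r := by
  have hE := nutE_pos hN hL le_rfl
  have hEc := continuous_nutE (N := N) (L := L)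
  set G : ℝ → ℝ := fun r => (63 / 4 * N ^ 2 + 11 * (r - N) * N + 2 * (r - N) ^ 2
    + L * (124 * (r - N) * N ^ 3 + 231 / 2 * (r - N) ^ 2 * N ^ 2 + 71 / 2 * (r - N) ^ 3 * N
      + 7 / 2 * (r - N) ^ 4)
    + L ^ 2 * (256 * (r - N) ^ 2 * N ^ 4 + 308 * (r - N) ^ 3 * N ^ 3 + 559 / 4 * (r - N) ^ 4 * N ^ 2
      + 57 / 2 * (r - N) ^ 5 * N + 9 / 4 * (r - N) ^ 6))
    / ((r + N) ^ 3 * nutE N L r) with hG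
  have hGc : ContinuousAt G N :=
    ContinuousAt.div (by fun_prop) (by fun_prop) (by positivity)
  have hGN : 6 / (7 * N) < G N := by
    have h1 : nutE N L N = 1 := by simp [nutE]
    have : G N = 63 / 32 * (1 / N) := by
      simp only [hG, h1]; field_simp; ring
    rw [this, div_eq_mul_one_div, ← one_div_mul_one_div]
    have : 0 < 1 / N := by positivity
    linarith
  have hev := hGc.eventually (lt_mem_nhds hGN)
  filter_upwards [nhdsWithin_le_nhds hev, self_mem_nhdsWithin] with r h1 hr
  have ht : 0 < r - N := sub_pos.2 hr
  rw [← div_div]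
  exact (div_le_div_iff_of_pos_right ht).2 h1.le

theorem potDiff_eq (hN : 0 < N) (hL : 0 < L) (hr : N < r) :
    potDiff N L r = -nutA N L r * (nutLogDeriv' N L (-3 / 4) (-1 / 4) (-1 / 4) r
        + nutLogDeriv N L (-3 / 4) (-1 / 4) (-1 / 4) r ^ 2)
      - (nutA' N L r + nutA N L r * (2 * r) / coeffB N r)
        * nutLogDeriv N L (-3 / 4) (-1 / 4) (-1 / 4) r
      + (1 / (N ^ 2 * nutA N L r) - 2 / coeffB N r) := by
  have hE := nutE_pos hN hL hr.le
  have hB : coeffB N r = (r - N) * (r + N) := by unfold coeffB; ring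
  obtain ⟨t, ht, rfl⟩ : ∃ t, 0 < t ∧ r = N + t := ⟨r - N, by linarith, by ring⟩
  have hR : 0 < N + t + N := by positivity
  simp only [potDiff, hB, nutLogDeriv, nutLogDeriv', nutA', nutA_eq_nutE, add_sub_cancel_left]
  have hE2 : nutE N L (N + t) = 1 + L * (t * (t + 4 * N)) := by unfold nutE; ring
  rw [hE2] at hE ⊢
  field_simp
  ring

theorem potRadial_eq (hN : 0 < N) (hL : 0 < L) (hr : N < r) :
    potRadial N L r = -nutA N L r * (nutLogDeriv' N L (-1 / 4) (-7 / 4) (-3 / 4) r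
        + nutLogDeriv N L (-1 / 4) (-7 / 4) (-3 / 4) r ^ 2)
      - (nutA' N L r / 2 - 2 * nutA N L r * nutLogDeriv N L (-1 / 4) (-7 / 4) (-3 / 4) r)
        * nutLogDeriv N L (-1 / 4) (-7 / 4) (-3 / 4) r
      + (2 * nutA N L r * (2 * (2 * r / (2 * coeffB N r)) ^ 2
          + (nutA' N L r / (2 * nutA N L r)) ^ 2)
        - 2 * (nutA N L r * ((2 * coeffB N r - (2 * r) ^ 2) / (2 * coeffB N r ^ 2))
          + nutA' N L r / 2 * (2 * r / (2 * coeffB N r)))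
        + 2 * (nutA N L r * (-1 / (r + N) - 2 * L * (r + N) / nutE N L r) + nutA' N L r / 2)
          * (3 * (2 * r / (2 * coeffB N r)) + nutA' N L r / (2 * nutA N L r))) := by
  have hE := nutE_pos hN hL hr.le
  have hB : coeffB N r = (r - N) * (r + N) := by unfold coeffB; ring
  obtain ⟨t, ht, rfl⟩ : ∃ t, 0 < t ∧ r = N + t := ⟨r - N, by linarith, by ring⟩
  have hR : 0 < N + t + N := by positivity
  simp only [potRadial, hB, nutLogDeriv, nutLogDeriv', nutA', nutA_eq_nutE, add_sub_cancel_left]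
  have hE2 : nutE N L (N + t) = 1 + L * (t * (t + 4 * N)) := by unfold nutE; ring
  rw [hE2] at hE ⊢
  field_simp
  ring

end
-- Reduction to Schrödinger form.
section

variable {N L ℓ r φ₁ : ℝ} {y w φ χ W f : ℝ → ℝ}

theorem isSchrodingerData_nut (hN : 0 < N) (hL : 0 < L) (hf : ContDiffOn ℝ ∞ f (Ioi N))
    (hfpos : ∀ r, N < r → 0 < f r) (hW : ContDiffOn ℝ ∞ W (Ioi N))
    (hWpos : ∀ r, N < r → 0 < W r) :
    IsSchrodingerData N f (fun r => √(nutA N L r)) (nutDist N L) (W ∘ nutRadius N L) where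
  f_smooth := hf
  f_pos := hfpos
  gg_smooth := contDiffOn_sqrt_nutA hN hL
  gg_pos _ hr := Real.sqrt_pos.2 (nutA_pos hN hL hr)
  rstar_deriv _ hr := hasDerivAt_nutDist hN hL hr
  rstar_bijOn := bijOn_nutDist hN hL
  V_smooth := hW.comp (contDiffOn_nutRadius hN hL) fun _ hx => nutRadius_mem hN hL hx
  V_pos r hr := by simpa [nutRadius_nutDist hN hL hr] using hWpos r hr

/-- First derivative of `w χ(r_*)`. -/
theorem deriv_weighted (hN : 0 < N) (hL : 0 < L) (hχ : ContDiffOn ℝ 2 χ (Ioi 0))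
    (hy : ∀ s, N < s → y s = w s * χ (nutDist N L s))
    (hw : ∀ s, N < s → HasDerivAt w (φ s * w s) s) (hr : N < r) :
    deriv y r = w r * (φ r * χ (nutDist N L r)
      + deriv χ (nutDist N L r) / √(nutA N L r)) := by
  have hx := nutDist_pos hN hL hr
  have h1 : HasDerivAt (fun s => χ (nutDist N L s))
      (deriv χ (nutDist N L r) * (1 / √(nutA N L r))) r :=
    (hχ.hasDerivAt_of_two isOpen_Ioi hx).comp r (hasDerivAt_nutDist hN hL hr)
  have h2 : y =ᶠ[nhds r] fun s => w s * χ (nutDist N L s) := by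
    filter_upwards [Ioi_mem_nhds hr] with s hs using hy s hs
  rw [h2.deriv_eq]
  refine HasDerivAt.deriv (((hw r hr).mul h1).congr_deriv ?_)
  ring

/-- Second derivative of `w χ(r_*)`. -/
theorem deriv_deriv_weighted (hN : 0 < N) (hL : 0 < L) (hχ : ContDiffOn ℝ 2 χ (Ioi 0))
    (hy : ∀ s, N < s → y s = w s * χ (nutDist N L s))
    (hw : ∀ s, N < s → HasDerivAt w (φ s * w s) s) (hr : N < r) (hφ : HasDerivAt φ φ₁ r) :
    deriv (deriv y) r = w r * ((φ₁ + φ r ^ 2) * χ (nutDist N L r)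
      + (2 * φ r - nutA' N L r / (2 * nutA N L r))
        * (deriv χ (nutDist N L r) / √(nutA N L r))
      + deriv (deriv χ) (nutDist N L r) / nutA N L r) := by
  have hx := nutDist_pos hN hL hr
  have hA := nutA_pos hN hL hr
  have hs : 0 < √(nutA N L r) := Real.sqrt_pos.2 hA
  have h1 : HasDerivAt (fun s => χ (nutDist N L s))
      (deriv χ (nutDist N L r) * (1 / √(nutA N L r))) r :=
    (hχ.hasDerivAt_of_two isOpen_Ioi hx).comp r (hasDerivAt_nutDist hN hL hr)
  have h1' : HasDerivAt (fun s => deriv χ (nutDist N L s))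
      (deriv (deriv χ) (nutDist N L r) * (1 / √(nutA N L r))) r :=
    (hχ.hasDerivAt_deriv_of_two isOpen_Ioi hx).comp r (hasDerivAt_nutDist hN hL hr)
  have h2 : deriv y =ᶠ[nhds r] fun s => w s * (φ s * χ (nutDist N L s)
      + deriv χ (nutDist N L s) / √(nutA N L s)) := by
    filter_upwards [Ioi_mem_nhds hr] with s hs using deriv_weighted hN hL hχ hy hw hs
  have h3 := (hw r hr).mul ((hφ.mul h1).add
    (h1'.div ((hasDerivAt_nutA (L := L) hN hr).sqrt hA.ne') hs.ne'))
  rw [h2.deriv_eq]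
  refine HasDerivAt.deriv (h3.congr_deriv ?_)
  simp only [Pi.add_apply, Pi.mul_apply, Pi.div_apply]
  have hsq : √(nutA N L r) ^ 2 = nutA N L r := Real.sq_sqrt hA.le
  generalize √(nutA N L r) = s at *
  rw [← hsq]
  field_simp
  ring

/-- The substitution `y = w χ(r_*)` turns `-A y'' - P y' + Q y` into a Schrödinger operator,
provided that the logarithmic derivative of `w` removes the first order term. -/
theorem operator_weighted {P Q : ℝ} (hN : 0 < N) (hL : 0 < L) (hχ : ContDiffOn ℝ 2 χ (Ioi 0))
    (hy : ∀ s, N < s → y s = w s * χ (nutDist N L s))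
    (hw : ∀ s, N < s → HasDerivAt w (φ s * w s) s) (hr : N < r) (hφ : HasDerivAt φ φ₁ r)
    (hP : P = nutA' N L r / 2 - 2 * nutA N L r * φ r)
    (hW : W r = -nutA N L r * (φ₁ + φ r ^ 2) - P * φ r + Q) :
    -nutA N L r * deriv (deriv y) r - P * deriv y r + Q * y r =
      w r * schrodingerOp (W ∘ nutRadius N L) χ (nutDist N L r) := by
  have hA := nutA_pos hN hL hr
  rw [deriv_deriv_weighted hN hL hχ hy hw hr hφ, deriv_weighted hN hL hχ hy hw hr, hy r hr,
    schrodingerOp, Function.comp_apply, nutRadius_nutDist hN hL hr, hW, hP]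
  field_simp
  ring

/-- The weight for the difference of two spatial mixed components. -/
noncomputable def weightDiff (N L : ℝ) : ℝ → ℝ := nutWeight N L (-3 / 4) (-1 / 4) (-1 / 4)

/-- The weight for the mixed `00` component. -/
noncomputable def weightRadial (N L : ℝ) : ℝ → ℝ := nutWeight N L (-1 / 4) (-7 / 4) (-3 / 4)

theorem operator_diff (hN : 0 < N) (hL : 0 < L) (hχ : ContDiffOn ℝ 2 χ (Ioi 0))
    (hy : ∀ s, N < s → y s = weightDiff N L s * χ (nutDist N L s)) (hr : N < r) :
    -nutA N L r * deriv (deriv y) r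
        - (nutA' N L r + nutA N L r * (2 * r) / coeffB N r) * deriv y r
        + (1 / (N ^ 2 * nutA N L r) - 2 / coeffB N r) * y r =
      weightDiff N L r * schrodingerOp (potDiff N L ∘ nutRadius N L) χ (nutDist N L r) := by
  -- The exponents `-3/4, -1/4, -1/4` are those of `A^(-1/4) B^(-1/2)`, the weight whose logarithmic
  -- derivative `φ` solves `P = A'/2 - 2Aφ` for `P = A' + A B'/B`.
  refine operator_weighted hN hL hχ hy (fun s hs => hasDerivAt_nutWeight hN hL hs) hr
    (hasDerivAt_nutLogDeriv hN hL hr) ?_ (potDiff_eq hN hL hr)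
  have hE := nutE_pos hN hL hr.le
  have hB : coeffB N r = (r - N) * (r + N) := by unfold coeffB; ring
  obtain ⟨t, ht, rfl⟩ : ∃ t, 0 < t ∧ r = N + t := ⟨r - N, by linarith, by ring⟩
  have hR : 0 < N + t + N := by positivity
  simp only [hB, nutLogDeriv, nutA', nutA_eq_nutE, add_sub_cancel_left]
  have hE2 : nutE N L (N + t) = 1 + L * (t * (t + 4 * N)) := by unfold nutE; ring
  rw [hE2] at hE ⊢
  field_simp
  ring

theorem operator_radial (hN : 0 < N) (hL : 0 < L) (hχ : ContDiffOn ℝ 2 χ (Ioi 0))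
    (hy : ∀ s, N < s → y s = weightRadial N L s * χ (nutDist N L s)) (hr : N < r) :
    -nutA N L r * deriv (deriv y) r
        - (2 * nutA N L r * (2 * r / (2 * coeffB N r) + 1 / (r + N)
          + 2 * L * (r + N) / nutE N L r)) * deriv y r
        + (2 * nutA N L r * (2 * (2 * r / (2 * coeffB N r)) ^ 2
            + (nutA' N L r / (2 * nutA N L r)) ^ 2)
          - 2 * (nutA N L r * ((2 * coeffB N r - (2 * r) ^ 2) / (2 * coeffB N r ^ 2))
            + nutA' N L r / 2 * (2 * r / (2 * coeffB N r)))
          + 2 * (nutA N L r * (-1 / (r + N) - 2 * L * (r + N) / nutE N L r) + nutA' N L r / 2)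
            * (3 * (2 * r / (2 * coeffB N r)) + nutA' N L r / (2 * nutA N L r))) * y r =
      weightRadial N L r * schrodingerOp (potRadial N L ∘ nutRadius N L) χ (nutDist N L r) := by
  have key : 2 * nutA N L r * (2 * r / (2 * coeffB N r) + 1 / (r + N)
      + 2 * L * (r + N) / nutE N L r) =
      nutA' N L r / 2 - 2 * nutA N L r * nutLogDeriv N L (-1 / 4) (-7 / 4) (-3 / 4) r := by
    have hE := nutE_pos hN hL hr.le
    have hB : coeffB N r = (r - N) * (r + N) := by unfold coeffB; ring
    obtain ⟨t, ht, rfl⟩ : ∃ t, 0 < t ∧ r = N + t := ⟨r - N, by linarith, by ring⟩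
    have hR : 0 < N + t + N := by positivity
    simp only [hB, nutLogDeriv, nutA', nutA_eq_nutE, add_sub_cancel_left]
    have hE2 : nutE N L (N + t) = 1 + L * (t * (t + 4 * N)) := by unfold nutE; ring
    rw [hE2] at hE ⊢
    field_simp
    ring
  -- The weight is `A^(1/4) B^(-1/2) / ((r + N) E)`: the last two factors absorb the first order
  -- terms produced by eliminating `y_3`.
  refine operator_weighted hN hL hχ hy (fun s hs => hasDerivAt_nutWeight hN hL hs) hr
    (hasDerivAt_nutLogDeriv hN hL hr) key ?_
  rw [key]
  exact potRadial_eq hN hL hr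

/-- Half the logarithmic derivative of `B / A`. -/
theorem half_logDeriv_sub (hN : 0 < N) (hL : 0 < L) (hr : N < r) :
    2 * r / (2 * coeffB N r) - nutA' N L r / (2 * nutA N L r) =
      (1 - 4 * N ^ 2 * L) / (nutE N L r * (r + N)) := by
  have hE := nutE_pos hN hL hr.le
  have hB : coeffB N r = (r - N) * (r + N) := by unfold coeffB; ring
  obtain ⟨t, ht, rfl⟩ : ∃ t, 0 < t ∧ r = N + t := ⟨r - N, by linarith, by ring⟩
  have hR : 0 < N + t + N := by positivity
  simp only [hB, nutA', nutA_eq_nutE, add_sub_cancel_left]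
  have hE2 : nutE N L (N + t) = 1 + L * (t * (t + 4 * N)) := by unfold nutE; ring
  rw [hE2] at hE ⊢
  field_simp
  ring

/-- The derivative of half the logarithmic derivative of `A / B`. -/
theorem half_logDeriv_sub_deriv (hN : 0 < N) (hL : 0 < L) (hr : N < r) :
    (nutA'' N L r * nutA N L r - nutA' N L r ^ 2) / (2 * nutA N L r ^ 2)
        - (2 * coeffB N r - (2 * r) ^ 2) / (2 * coeffB N r ^ 2) =
      (-1 / (r + N) - 2 * L * (r + N) / nutE N L r)
        * (nutA' N L r / (2 * nutA N L r) - 2 * r / (2 * coeffB N r)) := by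
  have hE := nutE_pos hN hL hr.le
  have hB : coeffB N r = (r - N) * (r + N) := by unfold coeffB; ring
  obtain ⟨t, ht, rfl⟩ : ∃ t, 0 < t ∧ r = N + t := ⟨r - N, by linarith, by ring⟩
  have hR : 0 < N + t + N := by positivity
  simp only [hB, nutA', nutA'', nutA_eq_nutE, add_sub_cancel_left]
  have hE2 : nutE N L (N + t) = 1 + L * (t * (t + 4 * N)) := by unfold nutE; ring
  rw [hE2] at hE ⊢
  field_simp
  ring

end

section

variable {N ℓ r : ℝ} {χ : ℝ → ℝ} {h : Tensor2} {a b : Fin 4}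

theorem IsDiagonalInvariant.deriv_mixedComp_sub {L : ℝ} (hh : IsDiagonalInvariant N h)
    (hN : 0 < N) (hL : 0 < L) (a b : Fin 4) (hr : N < r) :
    deriv (fun s => mixedComp N L h a s - mixedComp N L h b s) r =
      deriv (mixedComp N L h a) r - deriv (mixedComp N L h b) r :=
  (((hh.contDiffOn_mixedComp hN hL a).hasDerivAt_of_two isOpen_Ioi hr).sub
    ((hh.contDiffOn_mixedComp hN hL b).hasDerivAt_of_two isOpen_Ioi hr)).deriv

theorem IsDiagonalInvariant.deriv_deriv_mixedComp_sub {L : ℝ} (hh : IsDiagonalInvariant N h)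
    (hN : 0 < N) (hL : 0 < L) (a b : Fin 4) (hr : N < r) :
    deriv (deriv fun s => mixedComp N L h a s - mixedComp N L h b s) r =
      deriv (deriv (mixedComp N L h a)) r - deriv (deriv (mixedComp N L h b)) r := by
  have h1 : deriv (fun s => mixedComp N L h a s - mixedComp N L h b s) =ᶠ[nhds r]
      fun s => deriv (mixedComp N L h a) s - deriv (mixedComp N L h b) s := by
    filter_upwards [Ioi_mem_nhds hr] with s hs using hh.deriv_mixedComp_sub hN hL a b hs
  rw [h1.deriv_eq]
  exact (((hh.contDiffOn_mixedComp hN hL a).hasDerivAt_deriv_of_two isOpen_Ioi hr).sub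
    ((hh.contDiffOn_mixedComp hN hL b).hasDerivAt_deriv_of_two isOpen_Ioi hr)).deriv

/-- The difference of the `11` and `22` components of the modified Lichnerowicz operator. -/
theorem IsDiagonalInvariant.modLichnerowicz_one_sub_two (hh : IsDiagonalInvariant N h)
    (hN : 0 < N) (hℓ : 0 < ℓ) (hχ : ContDiffOn ℝ 2 χ (Ioi 0))
    (hy : ∀ s, N < s → mixedComp N (1 / ℓ ^ 2) h 1 s - mixedComp N (1 / ℓ ^ 2) h 2 s =
      weightDiff N (1 / ℓ ^ 2) s * χ (nutDist N (1 / ℓ ^ 2) s)) (hr : N < r) (q : SU2) :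
    modLichnerowicz (nutMetric N ℓ) h 1 1 (r, q) - modLichnerowicz (nutMetric N ℓ) h 2 2 (r, q) =
      coeffB N r * (weightDiff N (1 / ℓ ^ 2) r *
        schrodingerOp (potDiff N (1 / ℓ ^ 2) ∘ nutRadius N (1 / ℓ ^ 2)) χ
          (nutDist N (1 / ℓ ^ 2) r)) := by
  have hL : 0 < 1 / ℓ ^ 2 := by positivity
  rw [← operator_diff (y := fun s => mixedComp N (1 / ℓ ^ 2) h 1 s - mixedComp N (1 / ℓ ^ 2) h 2 s)
    hN hL hχ hy hr, hh.modLichnerowicz_eq hN hℓ 1 hr, hh.modLichnerowicz_eq hN hℓ 2 hr,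
    lichMixed_one_sub_two hN.ne' (nutA_pos hN hL hr).ne' (coeffB_pos hN hr).ne',
    hh.deriv_mixedComp_sub hN hL 1 2 hr, hh.deriv_deriv_mixedComp_sub hN hL 1 2 hr]

/-- The difference of the `11` and `33` components when `ℓ = 2N`, where the metric is hyperbolic. -/
theorem IsDiagonalInvariant.modLichnerowicz_one_sub_three (hh : IsDiagonalInvariant N h)
    (hN : 0 < N) (hℓ : 0 < ℓ) (hNℓ : 4 * N ^ 2 * (1 / ℓ ^ 2) = 1) (hχ : ContDiffOn ℝ 2 χ (Ioi 0))
    (hy : ∀ s, N < s → mixedComp N (1 / ℓ ^ 2) h 1 s - mixedComp N (1 / ℓ ^ 2) h 3 s =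
      weightDiff N (1 / ℓ ^ 2) s * χ (nutDist N (1 / ℓ ^ 2) s)) (hr : N < r) (q : SU2) :
    modLichnerowicz (nutMetric N ℓ) h 1 1 (r, q) - modLichnerowicz (nutMetric N ℓ) h 3 3 (r, q) =
      coeffB N r * (weightDiff N (1 / ℓ ^ 2) r *
        schrodingerOp (potDiff N (1 / ℓ ^ 2) ∘ nutRadius N (1 / ℓ ^ 2)) χ
          (nutDist N (1 / ℓ ^ 2) r)) := by
  have hL : 0 < 1 / ℓ ^ 2 := by positivity
  have hR : 0 < r + N := by linarith
  rw [← operator_diff (y := fun s => mixedComp N (1 / ℓ ^ 2) h 1 s - mixedComp N (1 / ℓ ^ 2) h 3 s)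
    hN hL hχ hy hr, hh.modLichnerowicz_eq hN hℓ 1 hr, hh.modLichnerowicz_eq hN hℓ 3 hr,
    hh.deriv_mixedComp_sub hN hL 1 3 hr, hh.deriv_deriv_mixedComp_sub hN hL 1 3 hr]
  set L := 1 / ℓ ^ 2
  -- If `4N²L = 1` then `E = L (r + N)²`, hence `A = L (r² - N²) = L B`; the next two equalities are
  -- the derivatives of this one.
  have e0 : coeffB N r = 4 * N ^ 2 * nutA N L r := by
    unfold coeffB nutA
    field_simp
    linear_combination (-(r + 3 * N) * (r - N) ^ 2) * hNℓ
  have e1 : 2 * r = 4 * N ^ 2 * nutA' N L r := by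
    unfold nutA'
    rw [hNℓ]
    linear_combination (-2 * (r + N) + 2 * N) * hNℓ
  have e2 : (2 : ℝ) = 4 * N ^ 2 * nutA'' N L r := by
    unfold nutA''
    rw [hNℓ]
    linear_combination (-2) * hNℓ
  have h3 := lichMixed_one_sub_three (N := N) (A := nutA N L r) (A₁ := nutA' N L r)
    (A₂ := nutA'' N L r) (y := (mixedComp N L h · r)) (y' := fun a => deriv (mixedComp N L h a) r)
    (y'' := fun a => deriv (deriv (mixedComp N L h a)) r) hN.ne' (nutA_pos hN hL hr).ne'
  rw [← e0, ← e1, ← e2] at h3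
  exact h3

/-- For transverse traceless tensors the `00` component of the modified Lichnerowicz operator
decouples. -/
theorem IsDiagonalInvariant.modLichnerowicz_zero (hh : IsDiagonalInvariant N h)
    (hTT : IsTT (nutMetric N ℓ) N h)
    (hN : 0 < N) (hℓ : 0 < ℓ) (hχ : ContDiffOn ℝ 2 χ (Ioi 0))
    (hy : ∀ s, N < s → mixedComp N (1 / ℓ ^ 2) h 0 s =
      weightRadial N (1 / ℓ ^ 2) s * χ (nutDist N (1 / ℓ ^ 2) s)) (hr : N < r) (q : SU2) :
    modLichnerowicz (nutMetric N ℓ) h 0 0 (r, q) =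
      (1 / nutA N (1 / ℓ ^ 2) r) * (weightRadial N (1 / ℓ ^ 2) r *
        schrodingerOp (potRadial N (1 / ℓ ^ 2) ∘ nutRadius N (1 / ℓ ^ 2)) χ
          (nutDist N (1 / ℓ ^ 2) r)) := by
  have hL : 0 < 1 / ℓ ^ 2 := by positivity
  have htr := hh.traceless hTT hN hℓ hr
  have htv := hh.transverse hTT hN hℓ hr
  have hd := half_logDeriv_sub_deriv hN hL hr
  have hA := (nutA_pos hN hL hr).ne'
  rw [← operator_radial hN hL hχ hy hr, hh.modLichnerowicz_eq hN hℓ 0 hr,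
    lichMixed_zero hN.ne' hA (coeffB_pos hN hr).ne']
  congr 1
  rw [Fin.sum_univ_four] at htr
  have e1 : nutA N (1 / ℓ ^ 2) r * (2 * r) / coeffB N r
      = 2 * nutA N (1 / ℓ ^ 2) r * (2 * r / (2 * coeffB N r)) := by
    have := (coeffB_pos hN hr).ne'
    field_simp
  have e2 : nutA' N (1 / ℓ ^ 2) r =
      2 * nutA N (1 / ℓ ^ 2) r * (nutA' N (1 / ℓ ^ 2) r / (2 * nutA N (1 / ℓ ^ 2) r)) := by
    field_simp
  have e3 : 1 / (r + N) = -(-1 / (r + N)) := by ring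
  rw [e1, e3]
  generalize mixedComp N (1 / ℓ ^ 2) h 0 r = y₀ at *
  generalize mixedComp N (1 / ℓ ^ 2) h 1 r = y₁ at *
  generalize mixedComp N (1 / ℓ ^ 2) h 2 r = y₂ at *
  generalize mixedComp N (1 / ℓ ^ 2) h 3 r = y₃ at *
  generalize deriv (deriv (mixedComp N (1 / ℓ ^ 2) h 0)) r = z'' at *
  generalize deriv (mixedComp N (1 / ℓ ^ 2) h 0) r = z' at *
  generalize nutA' N (1 / ℓ ^ 2) r / (2 * nutA N (1 / ℓ ^ 2) r) = c at *
  generalize 2 * r / (2 * coeffB N r) = b at *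
  generalize (nutA'' N (1 / ℓ ^ 2) r * nutA N (1 / ℓ ^ 2) r - nutA' N (1 / ℓ ^ 2) r ^ 2)
    / (2 * nutA N (1 / ℓ ^ 2) r ^ 2) = c' at *
  generalize (2 * coeffB N r - (2 * r) ^ 2) / (2 * coeffB N r ^ 2) = b' at *
  generalize nutA N (1 / ℓ ^ 2) r = A at *
  generalize nutA' N (1 / ℓ ^ 2) r = A₁ at *
  generalize 2 * (1 / ℓ ^ 2) * (r + N) / nutE N (1 / ℓ ^ 2) r = u at *
  generalize -1 / (r + N) = v at *
  obtain rfl : y₁ = -y₀ - y₂ - y₃ := by linarith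
  -- The difference `c - b` is a constant over `E (r + N)`, so its derivative is `(v - u)(c - b)`,
  -- where `v - u` is its logarithmic derivative.
  obtain rfl : c' = b' + (v - u) * (c - b) := by linarith
  subst e2
  -- After the trace condition, `y_3` enters with coefficient `2A (v - u + c)(c - b)`, and in the
  -- divergence with `b - c`. This multiple of the divergence therefore cancels it, with no
  -- assumption that `b ≠ c`.
  linear_combination (-2 * A * (v - u) - 2 * A * c) * htv

end
-- Vanishing of normalisable radial profiles for negative eigenvalues.
section

variable {N L r lam : ℝ} {y w χ W : ℝ → ℝ}

/-- The function `χ` with `y = w χ(r_*)`. -/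
noncomputable def profile (N L : ℝ) (y w : ℝ → ℝ) (x : ℝ) : ℝ :=
  y (nutRadius N L x) / w (nutRadius N L x)

theorem eq_mul_profile (hN : 0 < N) (hL : 0 < L) (hw : ∀ r, N < r → 0 < w r) (hr : N < r) :
    y r = w r * profile N L y w (nutDist N L r) := by
  have := (hw r hr).ne'
  rw [profile, nutRadius_nutDist hN hL hr]
  field_simp

theorem contDiffOn_profile (hN : 0 < N) (hL : 0 < L) (hy : ContDiffOn ℝ 2 y (Ioi N))
    (hwc : ContDiffOn ℝ 2 w (Ioi N)) (hw : ∀ r, N < r → 0 < w r) :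
    ContDiffOn ℝ 2 (profile N L y w) (Ioi 0) := by
  have h1 : ContDiffOn ℝ 2 (nutRadius N L) (Ioi 0) :=
    mod_cast contDiffOn_infty.1 (contDiffOn_nutRadius hN hL) 2
  have h2 : MapsTo (nutRadius N L) (Ioi 0) (Ioi N) := fun x hx => nutRadius_mem hN hL hx
  exact (hy.comp h1 h2).div (hwc.comp h1 h2) fun x hx => (hw _ (h2 hx)).ne'

/-- A bound `6 / (7 N (r - N)) ≤ W` near the nut gives `6 / x² ≤ W` in terms of the proper
distance, which moreover satisfies `x² ≤ 9 N (r - N)` there. -/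
theorem exists_near_nut (hN : 0 < N) (hL : 0 < L)
    (hW : ∀ᶠ r in nhdsWithin N (Ioi N), 6 / (7 * N * (r - N)) ≤ W r) :
    ∃ δ > 0, ∀ x, 0 < x → x < δ → 6 / x ^ 2 ≤ W (nutRadius N L x) ∧
      x ^ 2 ≤ 9 * N * (nutRadius N L x - N) ∧ nutRadius N L x ≤ N + 1 := by
  obtain ⟨ε, hε, hbd⟩ := exists_nutDist_bounds hN hL
  rw [eventually_nhdsWithin_iff] at hW
  obtain ⟨ε', hε', hball⟩ := Metric.eventually_nhds_iff.1 hW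
  set η := min (min ε ε') 1 with hη
  have hη0 : 0 < η := lt_min (lt_min hε hε') one_pos
  refine ⟨nutDist N L (N + η), nutDist_pos hN hL (by linarith), fun x hx hxδ => ?_⟩
  have hr := nutRadius_mem hN hL hx
  have hlt : nutRadius N L x < N + η := by
    by_contra! hge
    have := (strictMonoOn_nutDist hN hL).monotoneOn (show N + η ∈ Ioi N by simpa using hη0) hr hge
    rw [nutDist_nutRadius hN hL hx] at this
    linarith
  have h1 : η ≤ ε := (min_le_left _ _).trans (min_le_left _ _)
  have h2 : η ≤ ε' := (min_le_left _ _).trans (min_le_right _ _)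
  have h3 : η ≤ 1 := min_le_right _ _
  obtain ⟨ha, hb⟩ := hbd _ hr (by linarith)
  rw [nutDist_nutRadius hN hL hx] at ha hb
  refine ⟨?_, hb, by linarith⟩
  have ht : 0 < nutRadius N L x - N := by linarith
  refine le_trans ?_ (hball (y := nutRadius N L x) ?_ hr)
  · gcongr
  · rw [Real.dist_eq, abs_of_pos ht]
    linarith

/-- The first order system for a solution of `-χ'' + W χ = λ χ`. -/
theorem hasDerivAt_of_schrodinger (hχ : ContDiffOn ℝ 2 χ (Ioi 0))
    (heq : ∀ x, 0 < x → schrodingerOp W χ x = lam * χ x) (x : ℝ) (hx : 0 < x) :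
    HasDerivAt (deriv χ) ((W x - lam) * χ x) x := by
  refine (hχ.hasDerivAt_deriv_of_two isOpen_Ioi hx).congr_deriv ?_
  have := heq x hx
  unfold schrodingerOp at this
  linarith

theorem schrodinger_of_radius (hN : 0 < N) (hL : 0 < L)
    (heq : ∀ r, N < r → schrodingerOp W χ (nutDist N L r) = lam * χ (nutDist N L r))
    (x : ℝ) (hx : 0 < x) : schrodingerOp W χ x = lam * χ x := by
  simpa only [nutDist_nutRadius hN hL hx] using heq _ (nutRadius_mem hN hL hx)

/-- With this weight the norm of `y` is exactly the `L²` norm of `χ` in proper distance. -/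
theorem weightDiff_sq (hN : 0 < N) (hL : 0 < L) (hr : N < r) :
    weightDiff N L r ^ 2 * coeffB N r * √(nutA N L r) = 1 := by
  rw [weightDiff, nutWeight_sq_mul hN hL hr]
  norm_num

/-- The density vanishes like `x²` at the nut, giving only `x χ ∈ L²` there, and decays at infinity,
where a separate argument is needed. -/
theorem weightRadial_sq (hN : 0 < N) (hL : 0 < L) (hr : N < r) :
    weightRadial N L r ^ 2 * coeffB N r * √(nutA N L r) =
      (r - N) / ((r + N) ^ 3 * nutE N L r) := by
  have hE := nutE_pos hN hL hr.le
  have h1 : 0 < r - N := by linarith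
  have h2 : 0 < r + N := by linarith
  rw [weightRadial, nutWeight_sq_mul hN hL hr, show (r - N) / ((r + N) ^ 3 * nutE N L r) =
    Real.exp (Real.log (r - N) - (3 * Real.log (r + N) + Real.log (nutE N L r))) by
      rw [Real.exp_sub, Real.exp_add, Real.exp_log h1, Real.exp_log hE,
        show (3 : ℝ) = ((3 : ℕ) : ℝ) by norm_num, Real.exp_nat_mul, Real.exp_log h2]]
  congr 1
  ring

/-- Vanishing of a normalisable difference of components. -/
theorem eq_zero_of_diff (hN : 0 < N) (hL : 0 < L) (hlam : lam < 0)
    (hy : ContDiffOn ℝ 2 y (Ioi N))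
    (heq : ∀ r, N < r → schrodingerOp (potDiff N L ∘ nutRadius N L)
      (profile N L y (weightDiff N L)) (nutDist N L r) =
        lam * profile N L y (weightDiff N L) (nutDist N L r))
    (hint : IntegrableOn (fun r => y r ^ 2 * coeffB N r) (Ioi N)) (hr : N < r) : y r = 0 := by
  have hwpos : ∀ r, N < r → 0 < weightDiff N L r := fun _ _ => nutWeight_pos
  set χ := profile N L y (weightDiff N L) with hχdef
  have hχ : ContDiffOn ℝ 2 χ (Ioi 0) :=
    contDiffOn_profile hN hL hy (contDiffOn_nutWeight hN hL) hwpos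
  have h1 : ∀ x, 0 < x → HasDerivAt χ (deriv χ x) x :=
    fun x hx => hχ.hasDerivAt_of_two isOpen_Ioi hx
  have h2 := hasDerivAt_of_schrodinger hχ (schrodinger_of_radius hN hL heq)
  have hU : ∀ x, 0 < x → 0 ≤ (potDiff N L ∘ nutRadius N L) x - lam := fun x hx => by
    have := potDiff_pos hN hL (nutRadius_mem hN hL hx)
    simp only [Function.comp_apply]
    linarith
  have hχint : IntegrableOn (fun x => χ x ^ 2) (Ioi 0) := by
    rw [integrableOn_comp_nutDist_iff hN hL]
    refine hint.congr_fun (fun s hs => ?_) measurableSet_Ioi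
    have hA := Real.sqrt_pos.2 (nutA_pos hN hL hs)
    have h3 := weightDiff_sq hN hL hs
    have h4 : y s = weightDiff N L s * χ (nutDist N L s) := eq_mul_profile hN hL hwpos hs
    simp only [h4]
    field_simp
    linear_combination χ (nutDist N L s) ^ 2 * h3
  obtain ⟨δ, hδ, hnear⟩ := exists_near_nut hN hL (eventually_le_potDiff hN hL)
  have h5 : IntegrableOn (fun x => (x * χ x) ^ 2) (Ioo 0 δ) := by
    refine Integrable.mono' ((hχint.mono_set Ioo_subset_Ioi_self).const_mul (δ ^ 2)) ?_ ?_
    · refine ContinuousOn.aestronglyMeasurable ?_ measurableSet_Ioo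
      exact ((continuousOn_id.mul (hχ.continuousOn.mono Ioo_subset_Ioi_self)).pow 2)
    · filter_upwards [ae_restrict_mem measurableSet_Ioo] with x hx
      rw [Real.norm_of_nonneg (by positivity), mul_pow]
      have : x ^ 2 ≤ δ ^ 2 := pow_le_pow_left₀ hx.1.le hx.2.le 2
      gcongr
  have h6 := eq_zero_of_decaying h1 h2 hδ (fun x hx hxδ => by
      have := (hnear x hx hxδ).1
      simp only [Function.comp_apply]
      linarith)
    (fun x hx => mul_deriv_nonpos_of_integrableOn_sq h1 h2 hU hχint hx) h5 (nutDist_pos hN hL hr)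
  rw [eq_mul_profile (y := y) (w := weightDiff N L) hN hL hwpos hr, ← hχdef, h6, mul_zero]

/-- Vanishing of a normalisable `00` component. -/
theorem eq_zero_of_radial {z : ℝ → ℝ} {K : ℝ} (hN : 0 < N) (hL : 0 < L) (hlam : lam < 0)
    (hy : ContDiffOn ℝ 2 y (Ioi N))
    (heq : ∀ r, N < r → schrodingerOp (potRadial N L ∘ nutRadius N L)
      (profile N L y (weightRadial N L)) (nutDist N L r) =
        lam * profile N L y (weightRadial N L) (nutDist N L r))
    (hint : IntegrableOn (fun r => y r ^ 2 * coeffB N r) (Ioi N))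
    (hz : IntegrableOn (fun r => z r ^ 2 * coeffB N r) (Ioi N))
    (hyz : ∀ r, N < r → deriv y r
      + (3 * (2 * r / (2 * coeffB N r)) + nutA' N L r / (2 * nutA N L r)) * y r =
        K / (nutE N L r * (r + N)) * z r) (hr : N < r) : y r = 0 := by
  have hwpos : ∀ r, N < r → 0 < weightRadial N L r := fun _ _ => nutWeight_pos
  set χ := profile N L y (weightRadial N L) with hχdef
  have hχ : ContDiffOn ℝ 2 χ (Ioi 0) :=
    contDiffOn_profile hN hL hy (contDiffOn_nutWeight hN hL) hwpos
  have h1 : ∀ x, 0 < x → HasDerivAt χ (deriv χ x) x :=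
    fun x hx => hχ.hasDerivAt_of_two isOpen_Ioi hx
  have h2 := hasDerivAt_of_schrodinger hχ (schrodinger_of_radius hN hL heq)
  have hU : ∀ x, 0 < x → 0 ≤ (potRadial N L ∘ nutRadius N L) x - lam := fun x hx => by
    have := potRadial_pos hN hL (nutRadius_mem hN hL hx)
    simp only [Function.comp_apply]
    linarith
  have h4 : ∀ s, N < s → y s = weightRadial N L s * χ (nutDist N L s) :=
    fun s hs => eq_mul_profile hN hL hwpos hs
  -- behaviour at infinity
  set P : ℝ → ℝ := fun r => nutLogDeriv N L (-1 / 4) (-7 / 4) (-3 / 4) r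
    + (3 * (2 * r / (2 * coeffB N r)) + nutA' N L r / (2 * nutA N L r)) with hP
  have hPpos : ∀ s, N < s → 0 ≤ P s := by
    intro s hs
    have hE := nutE_pos hN hL hs.le
    have hB : coeffB N s = (s - N) * (s + N) := by unfold coeffB; ring
    obtain ⟨t, ht, rfl⟩ : ∃ t, 0 < t ∧ s = N + t := ⟨s - N, by linarith, by ring⟩
    have hR : 0 < N + t + N := by positivity
    have hE2 : nutE N L (N + t) = 1 + L * (t * (t + 4 * N)) := by unfold nutE; ring
    have : P (N + t) = (7 / 2 * N + t + L * (12 * t * N ^ 2 + 11 / 2 * t ^ 2 * N + 1 / 2 * t ^ 3))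
        / (t * (N + t + N) * nutE N L (N + t)) := by
      simp only [hP, hB, nutLogDeriv, nutA', nutA_eq_nutE, add_sub_cancel_left]
      rw [hE2] at hE ⊢
      field_simp
      ring
    rw [this]
    positivity
  -- Here `P = w'/w + 3b + c`, so `χ' + √A P χ = (√A / w)(y' + (3b + c) y)`. By `hyz` this is a
  -- multiple of `z`, and the weights combine so that its square, times `1/√A`, is exactly `K² z²
  -- B`.
  have hfar : IntegrableOn (fun x => (deriv χ x
      + √(nutA N L (nutRadius N L x)) * P (nutRadius N L x) * χ x) ^ 2) (Ioi 0) := by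
    rw [integrableOn_comp_nutDist_iff hN hL]
    refine IntegrableOn.congr_fun (hz.const_mul (K ^ 2)) (fun s hs => ?_) measurableSet_Ioi
    have hN' : 0 < s - N := sub_pos.2 hs
    have hR : 0 < s + N := add_pos (hN.trans hs) hN
    have hE := nutE_pos hN hL (le_of_lt hs)
    have hApos := nutA_pos hN hL hs
    have hA := Real.sqrt_pos.2 hApos
    have hsq : √(nutA N L s) ^ 2 = nutA N L s := Real.sq_sqrt hApos.le
    have hB := coeffB_pos hN hs
    have hw := hwpos s hs
    have h3 := weightRadial_sq hN hL hs
    have h5 := hyz s hs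
    rw [deriv_weighted hN hL hχ h4 (fun s hs => hasDerivAt_nutWeight hN hL hs) hs, h4 s hs] at h5
    simp only [nutRadius_nutDist hN hL hs]
    have h6 : deriv χ (nutDist N L s) + √(nutA N L s) * P s * χ (nutDist N L s) =
        √(nutA N L s) / weightRadial N L s * (K / (nutE N L s * (s + N)) * z s) := by
      rw [← h5]
      simp only [hP]
      field_simp
      ring
    have h7 : weightRadial N L s ^ 2 =
        (s - N) / ((s + N) ^ 3 * nutE N L s) / (coeffB N s * √(nutA N L s)) := by
      rw [← h3]; field_simp
    rw [h6, mul_pow, div_pow, h7]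
    have h8 : nutA N L s = (s - N) * nutE N L s / (s + N) := rfl
    rw [h8] at hsq
    rw [h8]
    generalize √((s - N) * nutE N L s / (s + N)) = v at *
    have h9 : v ^ 2 * (s + N) = (s - N) * nutE N L s := by rw [hsq]; field_simp
    field_simp
    linear_combination (-K ^ 2 * z s ^ 2) * h9
  have hdec : ∀ x, 0 < x → χ x * deriv χ x ≤ 0 := fun x hx =>
    mul_deriv_nonpos_of_integrableOn_add_sq h1 h2 hU
      (fun x hx => mul_nonneg (Real.sqrt_nonneg _) (hPpos _ (nutRadius_mem hN hL hx))) hfar hx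
  -- behaviour near the nut
  have hχint : IntegrableOn (fun x => (nutRadius N L x - N)
      / ((nutRadius N L x + N) ^ 3 * nutE N L (nutRadius N L x)) * χ x ^ 2) (Ioi 0) := by
    rw [integrableOn_comp_nutDist_iff hN hL]
    refine hint.congr_fun (fun s hs => ?_) measurableSet_Ioi
    have hA := Real.sqrt_pos.2 (nutA_pos hN hL hs)
    simp only [h4 s hs, nutRadius_nutDist hN hL hs, ← weightRadial_sq hN hL hs]
    field_simp
  obtain ⟨δ, hδ, hnear⟩ := exists_near_nut hN hL (eventually_le_potRadial hN hL)
  -- Near the nut `x² ≤ 9N (r - N)` and `r ≤ N + 1`; the constant bounds `x²` by a multiple of the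
  -- density of the norm.
  have h5 : IntegrableOn (fun x => (x * χ x) ^ 2) (Ioo 0 δ) := by
    refine Integrable.mono' ((hχint.mono_set Ioo_subset_Ioi_self).const_mul
      (9 * N * ((2 * N + 1) ^ 3 * (1 + L * (1 + 4 * N))))) ?_ ?_
    · refine ContinuousOn.aestronglyMeasurable ?_ measurableSet_Ioo
      exact ((continuousOn_id.mul (hχ.continuousOn.mono Ioo_subset_Ioi_self)).pow 2)
    · filter_upwards [ae_restrict_mem measurableSet_Ioo] with x hx
      rw [Real.norm_of_nonneg (by positivity), mul_pow, ← mul_assoc]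
      obtain ⟨-, h6, h7⟩ := hnear x hx.1 hx.2
      have h8 := nutRadius_mem hN hL hx.1
      generalize nutRadius N L x = s at *
      have hE := nutE_pos hN hL h8.le
      have h9 : 0 < s - N := by linarith
      have hR : 0 < s + N := by linarith
      have h10 : nutE N L s ≤ 1 + L * (1 + 4 * N) := by
        unfold nutE
        have : (s - N) * (s + 3 * N) ≤ 1 * (1 + 4 * N) := by
          apply mul_le_mul <;> linarith
        nlinarith
      have h11 : (s + N) ^ 3 * nutE N L s ≤ (2 * N + 1) ^ 3 * (1 + L * (1 + 4 * N)) := by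
        have h12 : s + N ≤ 2 * N + 1 := by linarith
        exact mul_le_mul (pow_le_pow_left₀ hR.le h12 3) h10 hE.le (by positivity)
      refine mul_le_mul_of_nonneg_right (h6.trans ?_) (sq_nonneg _)
      rw [mul_div_assoc', le_div_iff₀ (by positivity)]
      calc 9 * N * (s - N) * ((s + N) ^ 3 * nutE N L s)
          ≤ 9 * N * (s - N) * ((2 * N + 1) ^ 3 * (1 + L * (1 + 4 * N))) := by gcongr
        _ = _ := by ring
  have h6 := eq_zero_of_decaying h1 h2 hδ (fun x hx hxδ => by
      have := (hnear x hx hxδ).1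
      simp only [Function.comp_apply]
      linarith) hdec h5 (nutDist_pos hN hL hr)
  rw [h4 r hr, h6, mul_zero]

end

/-! ### Absence of normalisable negative modes. -/

section

variable {N ℓ r lam : ℝ} {h : Tensor2}

/-- Cauchy–Schwarz bounds any fixed combination of components by the full norm. -/
theorem IsDiagonalInvariant.integrableOn_comp (hh : IsDiagonalInvariant N h)
    (hn : IsNormalisable (nutMetric N ℓ) N h) (hN : 0 < N) (hℓ : 0 < ℓ) (v : Fin 4 → ℝ) :
    IntegrableOn (fun r => (∑ a, v a * mixedComp N (1 / ℓ ^ 2) h a r) ^ 2 * coeffB N r)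
      (Ioi N) := by
  have hL : 0 < 1 / ℓ ^ 2 := by positivity
  refine Integrable.mono' ((hh.integrableOn hn hN hℓ).const_mul (∑ a, v a ^ 2)) ?_ ?_
  · refine ContinuousOn.aestronglyMeasurable ?_ measurableSet_Ioi
    refine ContinuousOn.mul (ContinuousOn.pow (continuousOn_finsetSum _ fun a _ =>
      continuousOn_const.mul (hh.contDiffOn_mixedComp hN hL a).continuousOn) 2)
      (contDiffOn_coeffB (n := 0)).continuousOn
  · filter_upwards [ae_restrict_mem measurableSet_Ioi] with s hs
    have hB := coeffB_pos hN hs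
    rw [Real.norm_of_nonneg (by positivity), ← mul_assoc]
    exact mul_le_mul_of_nonneg_right (Finset.sum_mul_sq_le_sq_mul_sq _ _ _) hB.le

theorem IsEigenmode.mixedComp_eq (hh : IsDiagonalInvariant N h)
    (he : IsEigenmode (nutMetric N ℓ) N lam h) (hN : 0 < N) (hℓ : 0 < ℓ) (a : Fin 4) (hr : N < r) :
    modLichnerowicz (nutMetric N ℓ) h a a (r, 1) =
      lam * (nutVal N (1 / ℓ ^ 2) a r * mixedComp N (1 / ℓ ^ 2) h a r) := by
  rw [he a a r hr 1, hh.eq_radialDiag (L := 1 / ℓ ^ 2) hN (by positivity) a a r hr 1]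
  simp only [radialDiag, if_true]

theorem mixedComp_zero_eq_zero (hN : 0 < N) (hℓ : 0 < ℓ) (hlam : lam < 0)
    (hh : IsDiagonalInvariant N h) (hTT : IsTT (nutMetric N ℓ) N h)
    (he : IsEigenmode (nutMetric N ℓ) N lam h) (hn : IsNormalisable (nutMetric N ℓ) N h)
    (hr : N < r) : mixedComp N (1 / ℓ ^ 2) h 0 r = 0 := by
  have hL : 0 < 1 / ℓ ^ 2 := by positivity
  have hwpos : ∀ r, N < r → 0 < weightRadial N (1 / ℓ ^ 2) r := fun _ _ => nutWeight_pos
  have hyc := hh.contDiffOn_mixedComp hN hL 0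
  refine eq_zero_of_radial (z := mixedComp N (1 / ℓ ^ 2) h 3)
    -- From trace and divergence, `y_0' + (3b + c) y_0 = (c - b) y_3`, and `c - b = -(1 - 4N²L) / (E
    -- (r + N))`.
    (K := -(1 - 4 * N ^ 2 * (1 / ℓ ^ 2))) hN hL hlam hyc (fun s hs => ?_) ?_ ?_
    (fun s hs => ?_) hr
  · have h1 := hh.modLichnerowicz_zero hTT hN hℓ
      (contDiffOn_profile hN hL hyc (contDiffOn_nutWeight hN hL) hwpos)
      (fun s hs => eq_mul_profile (w := weightRadial N (1 / ℓ ^ 2)) hN hL hwpos hs) hs 1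
    rw [he.mixedComp_eq hh hN hℓ 0 hs,
      eq_mul_profile (y := mixedComp N (1 / ℓ ^ 2) h 0) (w := weightRadial N (1 / ℓ ^ 2))
        hN hL hwpos hs] at h1
    have hA := (nutA_pos hN hL hs).ne'
    have hw := (hwpos s hs).ne'
    have h2 : nutVal N (1 / ℓ ^ 2) 0 s = 1 / nutA N (1 / ℓ ^ 2) s := rfl
    rw [h2] at h1
    refine mul_left_cancel₀ hw (mul_left_cancel₀ (one_div_ne_zero hA) (h1.symm.trans ?_))
    ring
  · simpa [Fin.sum_univ_four] using hh.integrableOn_comp hn hN hℓ ![1, 0, 0, 0]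
  · simpa [Fin.sum_univ_four] using hh.integrableOn_comp hn hN hℓ ![0, 0, 0, 1]
  · have h1 := hh.traceless hTT hN hℓ hs
    have h2 := hh.transverse hTT hN hℓ hs
    have h3 := half_logDeriv_sub hN hL hs
    rw [Fin.sum_univ_four] at h1
    rw [neg_div, ← h3]
    linear_combination h2 + 2 * s / (2 * coeffB N s) * h1

theorem mixedComp_one_eq_two (hN : 0 < N) (hℓ : 0 < ℓ) (hlam : lam < 0)
    (hh : IsDiagonalInvariant N h)
    (he : IsEigenmode (nutMetric N ℓ) N lam h) (hn : IsNormalisable (nutMetric N ℓ) N h)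
    (hr : N < r) : mixedComp N (1 / ℓ ^ 2) h 1 r - mixedComp N (1 / ℓ ^ 2) h 2 r = 0 := by
  have hL : 0 < 1 / ℓ ^ 2 := by positivity
  have hwpos : ∀ r, N < r → 0 < weightDiff N (1 / ℓ ^ 2) r := fun _ _ => nutWeight_pos
  have hyc := (hh.contDiffOn_mixedComp hN hL 1).sub (hh.contDiffOn_mixedComp hN hL 2)
  refine eq_zero_of_diff (y := fun s => mixedComp N (1 / ℓ ^ 2) h 1 s
    - mixedComp N (1 / ℓ ^ 2) h 2 s) hN hL hlam hyc (fun s hs => ?_) ?_ hr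
  · have h0 := eq_mul_profile (y := fun s => mixedComp N (1 / ℓ ^ 2) h 1 s
      - mixedComp N (1 / ℓ ^ 2) h 2 s) (w := weightDiff N (1 / ℓ ^ 2)) hN hL hwpos hs
    have h1 := hh.modLichnerowicz_one_sub_two hN hℓ
      (contDiffOn_profile hN hL hyc (contDiffOn_nutWeight hN hL) hwpos)
      (fun s hs => eq_mul_profile (y := fun s => mixedComp N (1 / ℓ ^ 2) h 1 s
        - mixedComp N (1 / ℓ ^ 2) h 2 s) (w := weightDiff N (1 / ℓ ^ 2)) hN hL hwpos hs) hs 1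
    have h2 : nutVal N (1 / ℓ ^ 2) 1 s = coeffB N s := rfl
    have h3 : nutVal N (1 / ℓ ^ 2) 2 s = coeffB N s := rfl
    rw [he.mixedComp_eq hh hN hℓ 1 hs, he.mixedComp_eq hh hN hℓ 2 hs, h2, h3] at h1
    have hB := (coeffB_pos hN hs).ne'
    have hw := (hwpos s hs).ne'
    refine mul_left_cancel₀ hw (mul_left_cancel₀ hB (h1.symm.trans ?_))
    linear_combination lam * coeffB N s * h0
  · simpa [Fin.sum_univ_four, sub_eq_add_neg] using hh.integrableOn_comp hn hN hℓ ![0, 1, -1, 0]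

theorem mixedComp_one_eq_three (hN : 0 < N) (hℓ : 0 < ℓ) (hNℓ : 4 * N ^ 2 * (1 / ℓ ^ 2) = 1)
    (hlam : lam < 0) (hh : IsDiagonalInvariant N h)
    (he : IsEigenmode (nutMetric N ℓ) N lam h) (hn : IsNormalisable (nutMetric N ℓ) N h)
    (hr : N < r) : mixedComp N (1 / ℓ ^ 2) h 1 r - mixedComp N (1 / ℓ ^ 2) h 3 r = 0 := by
  have hL : 0 < 1 / ℓ ^ 2 := by positivity
  have hwpos : ∀ r, N < r → 0 < weightDiff N (1 / ℓ ^ 2) r := fun _ _ => nutWeight_pos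
  have hyc := (hh.contDiffOn_mixedComp hN hL 1).sub (hh.contDiffOn_mixedComp hN hL 3)
  refine eq_zero_of_diff (y := fun s => mixedComp N (1 / ℓ ^ 2) h 1 s
    - mixedComp N (1 / ℓ ^ 2) h 3 s) hN hL hlam hyc (fun s hs => ?_) ?_ hr
  · have h0 := eq_mul_profile (y := fun s => mixedComp N (1 / ℓ ^ 2) h 1 s
      - mixedComp N (1 / ℓ ^ 2) h 3 s) (w := weightDiff N (1 / ℓ ^ 2)) hN hL hwpos hs
    have h1 := hh.modLichnerowicz_one_sub_three hN hℓ hNℓ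
      (contDiffOn_profile hN hL hyc (contDiffOn_nutWeight hN hL) hwpos)
      (fun s hs => eq_mul_profile (y := fun s => mixedComp N (1 / ℓ ^ 2) h 1 s
        - mixedComp N (1 / ℓ ^ 2) h 3 s) (w := weightDiff N (1 / ℓ ^ 2)) hN hL hwpos hs) hs 1
    have h2 : nutVal N (1 / ℓ ^ 2) 1 s = coeffB N s := rfl
    have h3 : nutVal N (1 / ℓ ^ 2) 3 s = coeffB N s := by
      have hR : s + N ≠ 0 := (add_pos (hN.trans hs) hN).ne'
      change 4 * N ^ 2 * nutA N (1 / ℓ ^ 2) s = coeffB N s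
      unfold coeffB nutA
      generalize 1 / ℓ ^ 2 = L at *
      field_simp
      linear_combination ((s + 3 * N) * (s - N) ^ 2) * hNℓ
    rw [he.mixedComp_eq hh hN hℓ 1 hs, he.mixedComp_eq hh hN hℓ 3 hs, h2, h3] at h1
    have hB := (coeffB_pos hN hs).ne'
    have hw := (hwpos s hs).ne'
    refine mul_left_cancel₀ hw (mul_left_cancel₀ hB (h1.symm.trans ?_))
    linear_combination lam * coeffB N s * h0
  · simpa [Fin.sum_univ_four, sub_eq_add_neg] using hh.integrableOn_comp hn hN hℓ ![0, 1, 0, -1]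

theorem mixedComp_eq_zero (hN : 0 < N) (hℓ : 0 < ℓ) (hlam : lam < 0)
    (hh : IsDiagonalInvariant N h) (hTT : IsTT (nutMetric N ℓ) N h)
    (he : IsEigenmode (nutMetric N ℓ) N lam h) (hn : IsNormalisable (nutMetric N ℓ) N h)
    (a : Fin 4) (hr : N < r) : mixedComp N (1 / ℓ ^ 2) h a r = 0 := by
  have hL : 0 < 1 / ℓ ^ 2 := by positivity
  have h0 : ∀ s, N < s → mixedComp N (1 / ℓ ^ 2) h 0 s = 0 :=
    fun s hs => mixedComp_zero_eq_zero hN hℓ hlam hh hTT he hn hs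
  have h12 := mixedComp_one_eq_two hN hℓ hlam hh he hn hr
  have htr := hh.traceless hTT hN hℓ hr
  rw [Fin.sum_univ_four] at htr
  have h3 : mixedComp N (1 / ℓ ^ 2) h 3 r = 0 := by
    -- Once `y_0 = 0`, transversality reads `(b - c) y_3 = 0`. It is empty precisely when `ℓ = 2N`,
    -- where the extra symmetry replaces it.
    by_cases hNℓ : 4 * N ^ 2 * (1 / ℓ ^ 2) = 1
    · have h13 := mixedComp_one_eq_three hN hℓ hNℓ hlam hh he hn hr
      linarith [h0 r hr]
    · have htv := hh.transverse hTT hN hℓ hr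
      have hd : deriv (mixedComp N (1 / ℓ ^ 2) h 0) r = 0 := by
        have : mixedComp N (1 / ℓ ^ 2) h 0 =ᶠ[nhds r] fun _ => 0 := by
          filter_upwards [Ioi_mem_nhds hr] with s hs using h0 s hs
        rw [this.deriv_eq, deriv_const]
      have hk := half_logDeriv_sub hN hL hr
      have hne : (1 - 4 * N ^ 2 * (1 / ℓ ^ 2)) / (nutE N (1 / ℓ ^ 2) r * (r + N)) ≠ 0 := by
        have hE := nutE_pos hN hL hr.le
        have hR : 0 < r + N := by linarith
        exact div_ne_zero (sub_ne_zero.2 (Ne.symm hNℓ)) (by positivity)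
      rw [← hk] at hne
      rw [hd, h0 r hr] at htv
      rw [h0 r hr] at htr
      have h4 := mul_eq_zero.1 (show (2 * r / (2 * coeffB N r)
        - nutA' N (1 / ℓ ^ 2) r / (2 * nutA N (1 / ℓ ^ 2) r)) * mixedComp N (1 / ℓ ^ 2) h 3 r = 0 by
          linear_combination htv + 2 * r / (2 * coeffB N r) * htr)
      exact h4.resolve_left hne
  have := h0 r hr
  fin_cases a <;> simp only [Fin.zero_eta, Fin.mk_one, Fin.reduceFinMk] <;> linarith

end
end AdSTaubNUT

theorem mainTheorem3 (N ℓ : ℝ) (hN : 0 < N) (hℓ : 0 < ℓ) :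
    (∃ f gg rstar V : ℝ → ℝ, AdSTaubNUT.IsSchrodingerData N f gg rstar V ∧
      ∀ h : AdSTaubNUT.Tensor2, AdSTaubNUT.IsDiagonalInvariant N h →
        AdSTaubNUT.HasSchrodingerForm N f rstar V
          (fun p => h 1 1 p - h 2 2 p)
          (fun p => AdSTaubNUT.modLichnerowicz (AdSTaubNUT.nutMetric N ℓ) h 1 1 p
            - AdSTaubNUT.modLichnerowicz (AdSTaubNUT.nutMetric N ℓ) h 2 2 p)) ∧
    (∃ f gg rstar V : ℝ → ℝ, AdSTaubNUT.IsSchrodingerData N f gg rstar V ∧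
      ∀ h : AdSTaubNUT.Tensor2, AdSTaubNUT.IsDiagonalInvariant N h →
        AdSTaubNUT.IsTT (AdSTaubNUT.nutMetric N ℓ) N h →
        AdSTaubNUT.HasSchrodingerForm N f rstar V
          (fun p => h 0 0 p)
          (fun p => AdSTaubNUT.modLichnerowicz (AdSTaubNUT.nutMetric N ℓ) h 0 0 p)) ∧
    (∀ lam : ℝ, lam < 0 → ∀ h : AdSTaubNUT.Tensor2,
      AdSTaubNUT.IsDiagonalInvariant N h →
      AdSTaubNUT.IsTT (AdSTaubNUT.nutMetric N ℓ) N h →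
      AdSTaubNUT.IsEigenmode (AdSTaubNUT.nutMetric N ℓ) N lam h →
      AdSTaubNUT.IsNormalisable (AdSTaubNUT.nutMetric N ℓ) N h →
      ∀ a b, ∀ r, N < r → ∀ q, h a b (r, q) = 0) := by
  open AdSTaubNUT in
  have hL : 0 < 1 / ℓ ^ 2 := by positivity
  -- The factors `B` and `1/A` in the two choices of `f` convert mixed components back to covariant
  -- ones.
  refine ⟨⟨fun r => coeffB N r * weightDiff N (1 / ℓ ^ 2) r, _, _, _,
      isSchrodingerData_nut hN hL (contDiffOn_coeffB.mul (contDiffOn_nutWeight hN hL))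
        (fun r hr => mul_pos (coeffB_pos hN hr) nutWeight_pos)
        (contDiffOn_potDiff hN hL) (fun r hr => potDiff_pos hN hL hr),
      fun h hh χ hχ hY r hr q => ?_⟩,
    ⟨fun r => 1 / nutA N (1 / ℓ ^ 2) r * weightRadial N (1 / ℓ ^ 2) r, _, _, _,
      isSchrodingerData_nut hN hL
        ((contDiffOn_nutVal hN hL 0).mul (contDiffOn_nutWeight hN hL))
        (fun r hr => mul_pos (nutVal_pos hN hL 0 hr) nutWeight_pos)
        (contDiffOn_potRadial hN hL) (fun r hr => potRadial_pos hN hL hr),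
      fun h hh hTT χ hχ hY r hr q => ?_⟩,
    fun lam hlam h hh hTT he hn a b r hr q => ?_⟩
  · refine (hh.modLichnerowicz_one_sub_two hN hℓ hχ (fun s hs => ?_) hr q).trans
      (mul_assoc _ _ _).symm
    have hB := (coeffB_pos hN hs).ne'
    have h1 : h 1 1 (s, 1) - h 2 2 (s, 1) = coeffB N s * weightDiff N (1 / ℓ ^ 2) s
      * χ (nutDist N (1 / ℓ ^ 2) s) := hY s hs 1
    change h 1 1 (s, 1) / coeffB N s - h 2 2 (s, 1) / coeffB N s = _
    rw [← sub_div, h1]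
    field_simp
  · refine (hh.modLichnerowicz_zero hTT hN hℓ hχ (fun s hs => ?_) hr q).trans
      (mul_assoc _ _ _).symm
    have hA := (nutA_pos hN hL hs).ne'
    have h1 : h 0 0 (s, 1) = 1 / nutA N (1 / ℓ ^ 2) s * weightRadial N (1 / ℓ ^ 2) s
      * χ (nutDist N (1 / ℓ ^ 2) s) := hY s hs 1
    change h 0 0 (s, 1) / (1 / nutA N (1 / ℓ ^ 2) s) = _
    rw [h1]
    field_simp
  · rw [hh.eq_radialDiag hN hL a b r hr q]
    simp only [radialDiag, mixedComp_eq_zero hN hℓ hlam hh hTT he hn _ hr, mul_zero, ite_self]
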